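/- **Lieb inequality for the quaternion shearlet transform.** Let $n\ge 1$ and let $\mathbb H$ be the real quaternions with units $i,j,k$. Write points of $\mathbb R^{2n}$ as $w=(u,v)$ with $u,v\in\mathbb R^n$. The two-sided quaternion Fourier transform $$\mathcal F_Q(f)(u,v)=\int_{\mathbb R^n\times\mathbb R^n}e^{-2\pi i\,u\cdot x}f(x,y)e^{-2\pi j\,v\cdot y}\,dx\,dy,\qquad f\in L^1\cap L^2(\mathbb R^{2n},\mathbb H),$$ is extended by continuity to $L^2(\mathbb R^{2n},\mathbb H)$. For $a\in\mathbb R^*=\mathbb R\setminus\{0\}$ and $s\in\mathbb R^{2n-1}$ let $A_a=\mathrm{diag}\big(a,\mathrm{sg}(a)|a|^{1/(2n)},\dots,\mathrm{sg}(a)|a|^{1/(2n)}\big)$, and let $S_s$ be the $2n\times 2n$ identity matrix with its first row replaced by $(1,s_1,\dots,s_{2n-1})$. For $\psi,f\in L^2(\mathbb R^{2n},\mathbb H)$ and $t\in\mathbb R^{2n}$ put $$\psi_{a,s,t}(x)=|a|^{\frac1{4n}-1}\psi\big(A_a^{-1}S_s^{-1}(x-t)\big),\qquad \mathcal{SH}^Q_\psi(f)(a,s,t)=\int_{\mathbb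 R^{2n}}f(x)\overline{\psi_{a,s,t}(x)}\,dx .$$ Let $d\mu(a,s,t)=|a|^{-(2n+1)}\,da\,ds\,dt$ on $\mathbb R^*\times\mathbb R^{2n-1}\times\mathbb R^{2n}$, and let $\|\cdot\|_{p,\mu}$ be the norm of $L^p(d\mu)$. Write $\psi^*(x)=\overline{\psi(-x)}$ and $\lambda=(\lambda_1,\dots,\lambda_{2n})$. A function $\psi\in L^2(\mathbb R^{2n},\mathbb H)$ is an admissible shearlet if $$C_\psi=\int_{\mathbb R^{2n}}\frac{|\mathcal F_Q(\psi^*)(\lambda)|^2}{|\lambda_1|^{2n}}\,d\lambda<\infty .$$ Let $\varphi,\psi$ be admissible shearlets, each satisfying the following condition (stated for $h=\varphi$ and $h=\psi$): for almost every $(u,v)\in\mathbb R^{2n}$ and all $t\in\mathbb R^n$, $$\mathcal F_Q(h)(u,v)e^{-2\pi j\,v\cdot t}=e^{-2\pi j\,v\cdot t}\mathcal F_Q(h)(u,v),\qquad \mathcal F_Q(jh)(u,v)e^{-2\pi j\,v\cdot t}=j\,e^{-2\pi j\,v\cdot t}\mathcal F_Q(h)(u,v).$$ Let $p\in[1,\infty)$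 and $f,g\in L^2(\mathbb R^{2n},\mathbb H)$. Then the function $(a,s,t)\mapsto\mathcal{SH}^Q_\varphi(f)(a,s,t)\,\mathcal{SH}^Q_\psi(g)(a,s,t)$ belongs to $L^p(d\mu)$ and $$\big\|\mathcal{SH}^Q_\varphi(f)\,\mathcal{SH}^Q_\psi(g)\big\|_{p,\mu}\le\big(\sqrt{C_\varphi C_\psi}\big)^{1/p}\,\|f\|_2\,\|g\|_2\,\big(\|\varphi\|_2\|\psi\|_2\big)^{1-\frac1p}.$$ -/

import Mathlib

open MeasureTheory FourierTransform
open scoped Quaternion ENNReal Matrix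

noncomputable section

namespace QShearlet

/-- The Euclidean space `ℝ^m`. -/
abbrev Rn (m : ℕ) : Type := EuclideanSpace ℝ (Fin m)

/-- The quaternion unit `i`. -/
def qi : ℍ[ℝ] := ⟨0, 1, 0, 0⟩

/-- The quaternion unit `j`. -/
def qj : ℍ[ℝ] := ⟨0, 0, 1, 0⟩

/-- The exponential `e^{iθ}`. -/
def expI (θ : ℝ) : ℍ[ℝ] := NormedSpace.exp (θ • qi)

/-- The exponential `e^{jθ}`. -/
def expJ (θ : ℝ) : ℍ[ℝ] := NormedSpace.exp (θ • qj)

/-- The first `n` coordinates of a point of `ℝ^{2n}`. -/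
def fstHalf {n : ℕ} (x : Rn (2 * n)) : Rn n :=
  WithLp.toLp 2 fun k : Fin n => x ⟨k.val, by omega⟩

/-- The last `n` coordinates of a point of `ℝ^{2n}`. -/
def sndHalf {n : ℕ} (x : Rn (2 * n)) : Rn n :=
  WithLp.toLp 2 fun k : Fin n => x ⟨n + k.val, by omega⟩

/-- The two-sided quaternion Fourier integral
`∫ e^{-2πi u·x} f(x,y) e^{-2πj v·y} dx dy` on `ℝ^{2n} = ℝ^n × ℝ^n`, at `w = (u,v)`. -/
def qftIntegral {n : ℕ} (f : Rn (2 * n) → ℍ[ℝ]) (w : Rn (2 * n)) : ℍ[ℝ] :=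
  ∫ z : Rn (2 * n),
    expI (-(2 * Real.pi * inner ℝ (fstHalf w) (fstHalf z))) * f z *
      expJ (-(2 * Real.pi * inner ℝ (sndHalf w) (sndHalf z)))

/-! Auxiliary facts: Plancherel's formula on `L¹ ∩ L²`, needed to extend the
transform to `L²`. -/

@[simp] lemma qi_re : (qi).re = 0 := rfl
@[simp] lemma qi_imI : (qi).imI = 1 := rfl
@[simp] lemma qi_imJ : (qi).imJ = 0 := rfl
@[simp] lemma qi_imK : (qi).imK = 0 := rfl
@[simp] lemma qj_re : (qj).re = 0 := rfl
@[simp] lemma qj_imI : (qj).imI = 0 := rfl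
@[simp] lemma qj_imJ : (qj).imJ = 1 := rfl
@[simp] lemma qj_imK : (qj).imK = 0 := rfl

lemma expI_eq (θ : ℝ) : expI θ = (Real.cos θ : ℍ[ℝ]) + Real.sin θ • qi := by
  have hn : ‖θ • qi‖ = |θ| := by
    have h1 : ‖qi‖ * ‖qi‖ = 1 := by
      rw [← Quaternion.normSq_eq_norm_mul_self, Quaternion.normSq_def']; simp
    have : ‖qi‖ = 1 := by nlinarith [norm_nonneg qi]
    rw [norm_smul, this, mul_one, Real.norm_eq_abs]
  have h0 : (θ • qi).re = 0 := by simp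
  rw [expI, Quaternion.exp_of_re_eq_zero _ h0, hn, Real.cos_abs]
  have hs : Real.sin |θ| / |θ| * θ = Real.sin θ := by
    rcases lt_trichotomy θ 0 with h | h | h
    · rw [abs_of_neg h, Real.sin_neg, neg_div_neg_eq, div_mul_cancel₀ _ h.ne]
    · simp [h]
    · rw [abs_of_pos h, div_mul_cancel₀ _ h.ne']
  ext <;> simp [hs]

lemma expJ_eq (θ : ℝ) : expJ θ = (Real.cos θ : ℍ[ℝ]) + Real.sin θ • qj := by
  have hn : ‖θ • qj‖ = |θ| := by
    have h1 : ‖qj‖ * ‖qj‖ = 1 := by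
      rw [← Quaternion.normSq_eq_norm_mul_self, Quaternion.normSq_def']; simp
    have : ‖qj‖ = 1 := by nlinarith [norm_nonneg qj]
    rw [norm_smul, this, mul_one, Real.norm_eq_abs]
  have h0 : (θ • qj).re = 0 := by simp
  rw [expJ, Quaternion.exp_of_re_eq_zero _ h0, hn, Real.cos_abs]
  have hs : Real.sin |θ| / |θ| * θ = Real.sin θ := by
    rcases lt_trichotomy θ 0 with h | h | h
    · rw [abs_of_neg h, Real.sin_neg, neg_div_neg_eq, div_mul_cancel₀ _ h.ne]
    · simp [h]
    · rw [abs_of_pos h, div_mul_cancel₀ _ h.ne']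
  ext <;> simp [hs]

lemma norm_sq_eq (q : ℍ[ℝ]) :
    ‖q‖ ^ 2 = q.re ^ 2 + q.imI ^ 2 + q.imJ ^ 2 + q.imK ^ 2 := by
  rw [pow_two, ← Quaternion.normSq_eq_norm_mul_self, Quaternion.normSq_def']

/-- For an integrable and square integrable complex function the Fourier integral represents
the `L²` Fourier transform. -/
lemma fourier_toLp_ae {m : ℕ} {g : Rn m → ℂ} (h1 : Integrable g) (h2 : MemLp g 2 volume) :
    ((𝓕 (h2.toLp g) : Lp ℂ 2 (volume : Measure (Rn m))) : Rn m → ℂ) =ᵐ[volume] 𝓕 g := by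
  have hcont : Continuous (𝓕 g) :=
    VectorFourier.fourierIntegral_continuous Real.continuous_fourierChar
      (by exact continuous_inner) h1
  refine ae_eq_of_integral_contDiff_smul_eq
    ((Lp.memLp _).locallyIntegrable (by norm_num)) hcont.locallyIntegrable ?_
  intro φ hφ hc
  have hg₁ : HasCompactSupport (Complex.ofRealCLM ∘ φ) := hc.comp_left rfl
  have hg₂ : ContDiff ℝ (⊤ : ℕ∞) (Complex.ofRealCLM ∘ φ) := by fun_prop
  set Φ := hg₁.toSchwartzMap hg₂ with hΦ
  have hΦa : ∀ x, Φ x = (φ x : ℂ) := fun x => by simp [hΦ]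
  have e := Lp.fourier_toTemperedDistribution_eq (h2.toLp g)
  have e' := congrArg (fun T => T Φ) e
  simp only [TemperedDistribution.fourier_apply, Lp.toTemperedDistribution_apply] at e'
  have l : ∫ x, (φ x) • ((𝓕 (h2.toLp g) : Lp ℂ 2 (volume : Measure (Rn m))) : Rn m → ℂ) x
      = ∫ x, (𝓕 Φ) x • (h2.toLp g : Rn m → ℂ) x := by
    rw [e']
    refine integral_congr_ae (Filter.Eventually.of_forall fun x => ?_)
    simp [hΦa]
  rw [l]
  have hs := VectorFourier.integral_fourierIntegral_smul_eq_flip (e := Real.fourierChar)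
    (μ := (volume : Measure (Rn m))) (ν := (volume : Measure (Rn m))) (L := innerₗ (Rn m))
    (f := Φ) (g := g) Real.continuous_fourierChar (by exact continuous_inner) Φ.integrable h1
  rw [flip_innerₗ] at hs
  have hs' : ∫ x, (𝓕 Φ) x • g x = ∫ x, Φ x • (𝓕 g) x := by
    rw [SchwartzMap.fourier_coe]; exact hs
  calc _ = ∫ x, (𝓕 Φ) x • g x := by
        refine integral_congr_ae ?_
        filter_upwards [h2.coeFn_toLp] with x hx
        rw [hx]
    _ = ∫ x, Φ x • (𝓕 g) x := hs'
    _ = _ := by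
        refine integral_congr_ae (Filter.Eventually.of_forall fun x => ?_)
        simp [hΦa]

lemma memLp_fourier {m : ℕ} {g : Rn m → ℂ} (h1 : Integrable g) (h2 : MemLp g 2 volume) :
    MemLp (𝓕 g) 2 volume :=
  (memLp_congr_ae (fourier_toLp_ae h1 h2)).1 (Lp.memLp _)

lemma eLpNorm_fourier {m : ℕ} {g : Rn m → ℂ} (h1 : Integrable g) (h2 : MemLp g 2 volume) :
    eLpNorm (𝓕 g) 2 volume = eLpNorm g 2 volume := by
  rw [← eLpNorm_congr_ae (fourier_toLp_ae h1 h2), ← eLpNorm_congr_ae h2.coeFn_toLp,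
    ← Lp.enorm_def, ← Lp.enorm_def, enorm_eq_iff_norm_eq]
  exact Lp.norm_fourier_eq _

lemma lintegral_sq_fourier {m : ℕ} {g : Rn m → ℂ} (h1 : Integrable g)
    (h2 : MemLp g 2 volume) :
    ∫⁻ x, ‖𝓕 g x‖ₑ ^ 2 = ∫⁻ x, ‖g x‖ₑ ^ 2 := by
  have h := congrArg (· ^ 2) (eLpNorm_fourier h1 h2)
  have k := fun (u : Rn m → ℂ) => eLpNorm_nnreal_pow_eq_lintegral (f := u)
    (μ := (volume : Measure (Rn m))) (p := 2) (by norm_num)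
  have k1 := k g
  have k2 := k (𝓕 g)
  simp only [NNReal.coe_ofNat, ENNReal.rpow_ofNat, ENNReal.coe_ofNat] at k1 k2
  simpa [k1, k2] using h

/-- Components of a quaternion in the splitting `q = α (1 + k) + β (1 - k)`, `α, β ∈ ℂ`. -/
def splitP : ℍ[ℝ] →L[ℝ] ℂ := LinearMap.toContinuousLinearMap
  { toFun := fun q => ⟨(q.re + q.imK) / 2, (q.imI - q.imJ) / 2⟩
    map_add' := fun a b => by apply Complex.ext <;> simp <;> ring
    map_smul' := fun r a => by apply Complex.ext <;> simp <;> ring }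

def splitQ : ℍ[ℝ] →L[ℝ] ℂ := LinearMap.toContinuousLinearMap
  { toFun := fun q => ⟨(q.re - q.imK) / 2, (q.imI + q.imJ) / 2⟩
    map_add' := fun a b => by apply Complex.ext <;> simp <;> ring
    map_smul' := fun r a => by apply Complex.ext <;> simp <;> ring }

/-- The map `z ↦ z (1 + k)`. -/
def joinPFun (z : ℂ) : ℍ[ℝ] := ⟨z.re, z.im, -z.im, z.re⟩

/-- The map `z ↦ z (1 - k)`. -/
def joinQFun (z : ℂ) : ℍ[ℝ] := ⟨z.re, z.im, z.im, -z.re⟩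

@[simp] lemma joinPFun_re (z : ℂ) : (joinPFun z).re = z.re := rfl
@[simp] lemma joinPFun_imI (z : ℂ) : (joinPFun z).imI = z.im := rfl
@[simp] lemma joinPFun_imJ (z : ℂ) : (joinPFun z).imJ = -z.im := rfl
@[simp] lemma joinPFun_imK (z : ℂ) : (joinPFun z).imK = z.re := rfl
@[simp] lemma joinQFun_re (z : ℂ) : (joinQFun z).re = z.re := rfl
@[simp] lemma joinQFun_imI (z : ℂ) : (joinQFun z).imI = z.im := rfl
@[simp] lemma joinQFun_imJ (z : ℂ) : (joinQFun z).imJ = z.im := rfl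
@[simp] lemma joinQFun_imK (z : ℂ) : (joinQFun z).imK = -z.re := rfl

def joinP : ℂ →L[ℝ] ℍ[ℝ] := LinearMap.toContinuousLinearMap
  { toFun := joinPFun
    map_add' := fun a b => by ext <;> simp [add_comm]
    map_smul' := fun r a => by ext <;> simp }

def joinQ : ℂ →L[ℝ] ℍ[ℝ] := LinearMap.toContinuousLinearMap
  { toFun := joinQFun
    map_add' := fun a b => by ext <;> simp [add_comm]
    map_smul' := fun r a => by ext <;> simp }

lemma splitP_apply (q : ℍ[ℝ]) :
    splitP q = ⟨(q.re + q.imK) / 2, (q.imI - q.imJ) / 2⟩ := rfl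
lemma splitQ_apply (q : ℍ[ℝ]) :
    splitQ q = ⟨(q.re - q.imK) / 2, (q.imI + q.imJ) / 2⟩ := rfl
lemma joinP_apply (z : ℂ) : joinP z = joinPFun z := rfl
lemma joinQ_apply (z : ℂ) : joinQ z = joinQFun z := rfl

lemma norm_sq_join (z w : ℂ) :
    ‖joinP z + joinQ w‖ₑ ^ 2 = 2 * ‖z‖ₑ ^ 2 + 2 * ‖w‖ₑ ^ 2 := by
  have h : ‖joinP z + joinQ w‖ ^ 2 = 2 * ‖z‖ ^ 2 + 2 * ‖w‖ ^ 2 := by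
    rw [norm_sq_eq, Complex.sq_norm, Complex.sq_norm, Complex.normSq_apply,
      Complex.normSq_apply]
    simp [joinP_apply, joinQ_apply]
    ring
  have h' : ‖joinP z + joinQ w‖₊ ^ 2 = 2 * ‖z‖₊ ^ 2 + 2 * ‖w‖₊ ^ 2 := by
    apply NNReal.eq; push_cast; exact h
  simp only [enorm_eq_nnnorm]
  exact_mod_cast h'

lemma join_split (q : ℍ[ℝ]) : joinP (splitP q) + joinQ (splitQ q) = q := by
  ext <;> simp [joinP_apply, joinQ_apply, splitP_apply, splitQ_apply] <;> ring

lemma exp_mul_exp (θ η : ℝ) (q : ℍ[ℝ]) :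
    expI θ * q * expJ η =
      joinP (Complex.exp ((θ - η : ℝ) * Complex.I) * splitP q) +
        joinQ (Complex.exp ((θ + η : ℝ) * Complex.I) * splitQ q) := by
  rw [expI_eq, expJ_eq]
  ext <;>
  simp [joinP_apply, joinQ_apply, splitP_apply, splitQ_apply, Complex.exp_re, Complex.exp_im,
    Real.cos_add, Real.cos_sub, Real.sin_add, Real.sin_sub] <;> ring

/-- The reflection `(x, y) ↦ (x, -y)` of `ℝ^n × ℝ^n`. -/
def reflY (n : ℕ) : Rn (2 * n) ≃ₗᵢ[ℝ] Rn (2 * n) :=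
  LinearIsometryEquiv.piLpCongrRight 2 fun k : Fin (2 * n) =>
    if k.val < n then LinearIsometryEquiv.refl ℝ ℝ else LinearIsometryEquiv.neg ℝ

lemma sum_halves {n : ℕ} (g : Fin (2 * n) → ℝ) :
    ∑ k, g k = (∑ k : Fin n, g ⟨k.val, by omega⟩) + ∑ k : Fin n, g ⟨n + k.val, by omega⟩ := by
  rw [← Fin.sum_congr' g (two_mul n).symm, Fin.sum_univ_add]
  rfl

lemma inner_halves {n : ℕ} (x w : Rn (2 * n)) :
    inner ℝ x w = inner ℝ (fstHalf w) (fstHalf x) + inner ℝ (sndHalf w) (sndHalf x) := by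
  simp only [PiLp.inner_apply, fstHalf, sndHalf]
  rw [sum_halves]
  simp [mul_comm]

lemma inner_reflY {n : ℕ} (x w : Rn (2 * n)) :
    inner ℝ x (reflY n w) =
      inner ℝ (fstHalf w) (fstHalf x) - inner ℝ (sndHalf w) (sndHalf x) := by
  simp only [PiLp.inner_apply, fstHalf, sndHalf]
  rw [sum_halves]
  simp [reflY, mul_comm, sub_eq_add_neg]

lemma fourier_integrable {m : ℕ} {g : Rn m → ℂ} (h : Integrable g) (w : Rn m) :
    Integrable fun x => Complex.exp ((-(2 * Real.pi * inner ℝ x w) : ℝ) * Complex.I) * g x := by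
  refine (integrable_norm_iff ?_).1 ?_
  · refine AEStronglyMeasurable.mul (Continuous.aestronglyMeasurable (by fun_prop)) h.1
  · simp only [norm_mul, Complex.norm_exp_ofReal_mul_I, one_mul]; exact h.norm

lemma fourier_eq_exp {m : ℕ} (g : Rn m → ℂ) (w : Rn m) :
    𝓕 g w = ∫ x, Complex.exp ((-(2 * Real.pi * inner ℝ x w) : ℝ) * Complex.I) * g x := by
  rw [Real.fourier_eq']
  refine integral_congr_ae (Filter.Eventually.of_forall fun x => ?_)
  simp

lemma qftIntegral_eq {n : ℕ} {f : Rn (2 * n) → ℍ[ℝ]} (hf : Integrable f) (w : Rn (2 * n)) :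
    qftIntegral f w = joinP (𝓕 (fun x => splitP (f x)) (reflY n w)) +
      joinQ (𝓕 (fun x => splitQ (f x)) w) := by
  have hP := fourier_integrable (splitP.integrable_comp hf) (reflY n w)
  have hQ := fourier_integrable (splitQ.integrable_comp hf) w
  rw [fourier_eq_exp, fourier_eq_exp, ← joinP.integral_comp_comm hP,
    ← joinQ.integral_comp_comm hQ,
    ← integral_add (joinP.integrable_comp hP) (joinQ.integrable_comp hQ)]
  refine integral_congr_ae (Filter.Eventually.of_forall fun x => ?_)
  beta_reduce
  rw [exp_mul_exp, inner_reflY, inner_halves x w]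
  congr 4 <;> push_cast <;> ring_nf

lemma memLp_qftIntegral {n : ℕ} {f : Rn (2 * n) → ℍ[ℝ]} (h1 : Integrable f)
    (h2 : MemLp f 2 volume) : MemLp (qftIntegral f) 2 volume := by
  have hP := memLp_fourier (splitP.integrable_comp h1) (splitP.comp_memLp' h2)
  have hQ := memLp_fourier (splitQ.integrable_comp h1) (splitQ.comp_memLp' h2)
  have := (joinP.comp_memLp' (hP.comp_measurePreserving (reflY n).measurePreserving)).add
    (joinQ.comp_memLp' hQ)
  refine (memLp_congr_ae (Filter.Eventually.of_forall fun w => ?_)).2 this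
  exact qftIntegral_eq h1 w

/-- Plancherel's formula for the two-sided quaternion Fourier transform on `L¹ ∩ L²`. -/
lemma eLpNorm_qftIntegral {n : ℕ} {f : Rn (2 * n) → ℍ[ℝ]} (h1 : Integrable f)
    (h2 : MemLp f 2 volume) : eLpNorm (qftIntegral f) 2 volume = eLpNorm f 2 volume := by
  have hP := memLp_fourier (splitP.integrable_comp h1) (splitP.comp_memLp' h2)
  have hP2 := lintegral_sq_fourier (splitP.integrable_comp h1) (splitP.comp_memLp' h2)
  have hQ2 := lintegral_sq_fourier (splitQ.integrable_comp h1) (splitQ.comp_memLp' h2)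
  have hPm : AEMeasurable (fun w => 2 * ‖𝓕 (fun x => splitP (f x)) w‖ₑ ^ 2) volume :=
    (hP.1.enorm.pow_const 2).const_mul 2
  have hPm' : AEMeasurable (fun w => 2 * ‖𝓕 (fun x => splitP (f x)) (reflY n w)‖ₑ ^ 2) volume :=
    hPm.comp_quasiMeasurePreserving (reflY n).measurePreserving.quasiMeasurePreserving
  have hfm : AEMeasurable (fun w => 2 * ‖splitP (f w)‖ₑ ^ 2) volume :=
    (((splitP.comp_memLp' h2).1.enorm).pow_const 2).const_mul 2
  have main : ∫⁻ w, ‖qftIntegral f w‖ₑ ^ 2 = ∫⁻ x, ‖f x‖ₑ ^ 2 := by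
    calc ∫⁻ w, ‖qftIntegral f w‖ₑ ^ 2
        = ∫⁻ w, (2 * ‖𝓕 (fun x => splitP (f x)) (reflY n w)‖ₑ ^ 2 +
            2 * ‖𝓕 (fun x => splitQ (f x)) w‖ₑ ^ 2) := by
          refine lintegral_congr fun w => ?_
          rw [qftIntegral_eq h1, norm_sq_join]
      _ = 2 * (∫⁻ w, ‖𝓕 (fun x => splitP (f x)) w‖ₑ ^ 2) +
            2 * ∫⁻ w, ‖𝓕 (fun x => splitQ (f x)) w‖ₑ ^ 2 := by
          rw [lintegral_add_left' hPm',
            (reflY n).measurePreserving.lintegral_comp_emb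
              (reflY n).toHomeomorph.measurableEmbedding
              (fun w => 2 * ‖𝓕 (fun x => splitP (f x)) w‖ₑ ^ 2),
            lintegral_const_mul' _ _ (by simp), lintegral_const_mul' _ _ (by simp)]
      _ = 2 * (∫⁻ w, ‖splitP (f w)‖ₑ ^ 2) + 2 * ∫⁻ w, ‖splitQ (f w)‖ₑ ^ 2 := by
          rw [hP2, hQ2]
      _ = ∫⁻ x, ‖f x‖ₑ ^ 2 := by
          rw [← lintegral_const_mul' _ _ (by simp), ← lintegral_const_mul' _ _ (by simp),
            ← lintegral_add_left' hfm]
          refine lintegral_congr fun w => ?_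
          rw [← norm_sq_join, join_split]
  have k := fun (u : Rn (2 * n) → ℍ[ℝ]) => eLpNorm_nnreal_pow_eq_lintegral (f := u)
    (μ := (volume : Measure (Rn (2 * n)))) (p := 2) (by norm_num)
  have k1 := k f
  have k2 := k (qftIntegral f)
  simp only [NNReal.coe_ofNat, ENNReal.rpow_ofNat, ENNReal.coe_ofNat] at k1 k2
  exact (ENNReal.pow_right_strictMono (n := 2) (by norm_num)).injective
    (by simp only [k1, k2, main])

lemma qft_integrand_integrable {n : ℕ} {f : Rn (2 * n) → ℍ[ℝ]} (hf : Integrable f)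
    (w : Rn (2 * n)) : Integrable fun z : Rn (2 * n) =>
      expI (-(2 * Real.pi * inner ℝ (fstHalf w) (fstHalf z))) * f z *
        expJ (-(2 * Real.pi * inner ℝ (sndHalf w) (sndHalf z))) := by
  have hP := fourier_integrable (splitP.integrable_comp hf) (reflY n w)
  have hQ := fourier_integrable (splitQ.integrable_comp hf) w
  refine ((joinP.integrable_comp hP).add (joinQ.integrable_comp hQ)).congr
    (Filter.Eventually.of_forall fun x => ?_)
  simp only [Pi.add_apply]
  beta_reduce
  rw [exp_mul_exp, inner_reflY, inner_halves x w]
  congr 4 <;> push_cast <;> ring_nf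

/-- The real subspace `L¹(ℝ^{2n}, ℍ) ∩ L²(ℝ^{2n}, ℍ)` of `L²(ℝ^{2n}, ℍ)`. -/
def L1L2 (n : ℕ) : Submodule ℝ (Lp ℍ[ℝ] 2 (volume : Measure (Rn (2 * n)))) where
  carrier := {f | Integrable (f : Rn (2 * n) → ℍ[ℝ]) volume}
  zero_mem' := (integrable_zero _ _ _).congr (Lp.coeFn_zero _ _ _).symm
  add_mem' := by
    intro f g hf hg
    rw [Set.mem_ofPred_eq] at hf hg ⊢
    exact (hf.add hg).congr (Lp.coeFn_add f g).symm
  smul_mem' := by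
    intro c f hf
    rw [Set.mem_ofPred_eq] at hf ⊢
    exact (hf.smul c).congr (Lp.coeFn_smul c f).symm

lemma qftIntegral_congr {n : ℕ} {f g : Rn (2 * n) → ℍ[ℝ]} (h : f =ᵐ[volume] g) :
    qftIntegral f = qftIntegral g := by
  funext w
  refine integral_congr_ae ?_
  filter_upwards [h] with x hx
  rw [hx]

lemma qftIntegral_add {n : ℕ} {f g : Rn (2 * n) → ℍ[ℝ]} (hf : Integrable f)
    (hg : Integrable g) : qftIntegral (f + g) = qftIntegral f + qftIntegral g := by
  funext w
  simp only [qftIntegral, Pi.add_apply]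
  rw [← integral_add (qft_integrand_integrable hf w) (qft_integrand_integrable hg w)]
  refine integral_congr_ae (Filter.Eventually.of_forall fun x => ?_)
  simp only [mul_add, add_mul]

lemma qftIntegral_smul {n : ℕ} (c : ℝ) (f : Rn (2 * n) → ℍ[ℝ]) :
    qftIntegral (c • f) = c • qftIntegral f := by
  funext w
  simp only [qftIntegral, Pi.smul_apply]
  rw [← integral_smul]
  refine integral_congr_ae (Filter.Eventually.of_forall fun x => ?_)
  simp only [mul_smul_comm, smul_mul_assoc]

lemma memLp_qft_L1L2 {n : ℕ} (f : L1L2 n) :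
    MemLp (qftIntegral (f.1 : Rn (2 * n) → ℍ[ℝ])) 2 volume :=
  memLp_qftIntegral f.2 (Lp.memLp f.1)

lemma qft_L1L2_add {n : ℕ} (f g : L1L2 n) :
    (memLp_qft_L1L2 (f + g)).toLp = (memLp_qft_L1L2 f).toLp + (memLp_qft_L1L2 g).toLp := by
  have h : qftIntegral ((f + g).1 : Rn (2 * n) → ℍ[ℝ]) = qftIntegral f.1 + qftIntegral g.1 :=
    (qftIntegral_congr (Lp.coeFn_add f.1 g.1)).trans (qftIntegral_add f.2 g.2)
  rw [← MemLp.toLp_add]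
  exact MemLp.toLp_congr _ _ (Filter.Eventually.of_forall fun w => congrFun h w)

lemma qft_L1L2_smul {n : ℕ} (c : ℝ) (f : L1L2 n) :
    (memLp_qft_L1L2 (c • f)).toLp = c • (memLp_qft_L1L2 f).toLp := by
  have h : qftIntegral ((c • f).1 : Rn (2 * n) → ℍ[ℝ]) = c • qftIntegral f.1 :=
    (qftIntegral_congr (Lp.coeFn_smul c f.1)).trans (qftIntegral_smul c _)
  exact (MemLp.toLp_congr _ ((memLp_qft_L1L2 f).const_smul c)
    (Filter.Eventually.of_forall fun w => congrFun h w)).trans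
      (MemLp.toLp_const_smul c (memLp_qft_L1L2 f))

/-- The two-sided quaternion Fourier transform `L¹ ∩ L² → L²`. -/
def qftL1L2 (n : ℕ) : L1L2 n →ₗ[ℝ] Lp ℍ[ℝ] 2 (volume : Measure (Rn (2 * n))) where
  toFun f := (memLp_qft_L1L2 f).toLp
  map_add' := qft_L1L2_add
  map_smul' := qft_L1L2_smul

/-- The two-sided quaternion Fourier transform on `L²(ℝ^{2n}, ℍ)`: the continuous extension of
the transform on `L¹ ∩ L²`. -/
def qftL2 (n : ℕ) : Lp ℍ[ℝ] 2 (volume : Measure (Rn (2 * n))) →L[ℝ]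
    Lp ℍ[ℝ] 2 (volume : Measure (Rn (2 * n))) :=
  (qftL1L2 n).extendOfNorm (L1L2 n).subtype

lemma norm_qftL1L2 {n : ℕ} (f : L1L2 n) : ‖qftL1L2 n f‖ = ‖f.1‖ := by
  rw [← enorm_eq_iff_norm_eq, Lp.enorm_def, Lp.enorm_def,
    ← eLpNorm_qftIntegral f.2 (Lp.memLp f.1)]
  exact eLpNorm_congr_ae (memLp_qft_L1L2 f).coeFn_toLp

lemma dense_L1L2 (n : ℕ) : DenseRange (L1L2 n).subtype := by
  have h := Lp.simpleFunc.denseRange (E := ℍ[ℝ]) (p := 2)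
    (μ := (volume : Measure (Rn (2 * n)))) (by norm_num)
  refine Dense.mono ?_ h
  rintro _ ⟨g, rfl⟩
  refine ⟨⟨g.1, ?_⟩, rfl⟩
  have h1 : MemLp (Lp.simpleFunc.toSimpleFunc g) 2 volume := Lp.simpleFunc.memLp g
  have h2 : Integrable (Lp.simpleFunc.toSimpleFunc g) volume :=
    (SimpleFunc.memLp_iff_integrable (by norm_num) (by norm_num)).1 h1
  exact h2.congr (Lp.simpleFunc.toSimpleFunc_eq_toFun g)

/-- On `L¹ ∩ L²` the extended transform is the integral transform. -/
lemma qftL2_eq {n : ℕ} (f : L1L2 n) : qftL2 n f.1 = qftL1L2 n f :=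
  LinearMap.extendOfNorm_eq (dense_L1L2 n)
    ⟨1, fun x => by rw [one_mul]; exact (norm_qftL1L2 x).le⟩ f

open Classical in
/-- The two-sided quaternion Fourier transform `ℱ_Q f` of a function `f ∈ L²(ℝ^{2n}, ℍ)`,
as a function defined almost everywhere (and `0` when `f ∉ L²`). -/
def qft {n : ℕ} (f : Rn (2 * n) → ℍ[ℝ]) : Rn (2 * n) → ℍ[ℝ] :=
  if hf : MemLp f 2 volume then qftL2 n (hf.toLp f) else 0

/-- On `L¹ ∩ L²` the transform is almost everywhere the Fourier integral. -/
lemma qft_ae_eq {n : ℕ} {f : Rn (2 * n) → ℍ[ℝ]} (h1 : Integrable f) (h2 : MemLp f 2 volume) :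
    qft f =ᵐ[volume] qftIntegral f := by
  have h := qftL2_eq ⟨h2.toLp f, h1.congr h2.coeFn_toLp.symm⟩
  rw [qft, dif_pos h2, h, ← qftIntegral_congr h2.coeFn_toLp]
  exact (memLp_qft_L1L2 _).coeFn_toLp

/-- The hypothesis of the convolution theorem on a function `g`, for almost every `w = (u,v)`:
`ℱ_Q(g)(w) e^{-2πj v·t} = e^{-2πj v·t} ℱ_Q(g)(w)` and
`ℱ_Q(jg)(w) e^{-2πj v·t} = j e^{-2πj v·t} ℱ_Q(g)(w)` for all `t ∈ ℝ^n`. -/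
def ConvCondition {n : ℕ} (g : Rn (2 * n) → ℍ[ℝ]) : Prop :=
  ∀ᵐ w : Rn (2 * n), ∀ t : Rn n,
    qft g w * expJ (-(2 * Real.pi * inner ℝ (sndHalf w) t)) =
        expJ (-(2 * Real.pi * inner ℝ (sndHalf w) t)) * qft g w ∧
      qft (fun x => qj * g x) w * expJ (-(2 * Real.pi * inner ℝ (sndHalf w) t)) =
        qj * expJ (-(2 * Real.pi * inner ℝ (sndHalf w) t)) * qft g w

/-- The dilation matrix `A_a = diag(a, sg(a)|a|^{1/(2n)}, …, sg(a)|a|^{1/(2n)})`. -/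
def dilationMatrix (n : ℕ) (a : ℝ) : Matrix (Fin (2 * n)) (Fin (2 * n)) ℝ :=
  Matrix.diagonal fun k =>
    if k.val = 0 then a else Real.sign a * |a| ^ (1 / (2 * (n : ℝ)))

/-- The shear matrix `S_s`: the identity matrix with first row `(1, s_1, …, s_{2n-1})`. -/
def shearMatrix {n : ℕ} (s : Rn (2 * n - 1)) : Matrix (Fin (2 * n)) (Fin (2 * n)) ℝ :=
  Matrix.of fun k l =>
    if k = l then 1 else if k.val = 0 then s ⟨l.val - 1, by omega⟩ else 0

/-- `ψ_{a,s,t}(x) = |a|^{1/(4n) - 1} ψ(A_a⁻¹ S_s⁻¹ (x - t))`. -/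
def shearlet {n : ℕ} (ψ : Rn (2 * n) → ℍ[ℝ]) (a : ℝ) (s : Rn (2 * n - 1)) (t : Rn (2 * n)) :
    Rn (2 * n) → ℍ[ℝ] := fun x =>
  |a| ^ (1 / (4 * (n : ℝ)) - 1) •
    ψ (WithLp.toLp 2 (((dilationMatrix n a)⁻¹ * (shearMatrix s)⁻¹) *ᵥ (x - t).ofLp))

/-- `ψ^*(x) = conj (ψ(-x))`. -/
def starRefl {n : ℕ} (ψ : Rn (2 * n) → ℍ[ℝ]) : Rn (2 * n) → ℍ[ℝ] := fun x => star (ψ (-x))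

/-- The admissibility constant `C_ψ = ∫ |ℱ_Q(ψ^*)(λ)|² / |λ_1|^{2n} dλ ∈ [0, ∞]`. -/
def admConst {n : ℕ} [NeZero n] (ψ : Rn (2 * n) → ℍ[ℝ]) : ℝ≥0∞ :=
  ∫⁻ w : Rn (2 * n), ENNReal.ofReal (‖qft (starRefl ψ) w‖ ^ 2 / |w 0| ^ (2 * n))

/-- Admissible quaternion shearlets: `ψ ∈ L²(ℝ^{2n}, ℍ)` with `C_ψ < ∞`. -/
def IsAdmissible {n : ℕ} [NeZero n] (ψ : Rn (2 * n) → ℍ[ℝ]) : Prop :=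
  MemLp ψ 2 volume ∧ admConst ψ < ∞

/-- The continuous quaternion shearlet transform
`SH_ψ(f)(a,s,t) = ∫ f(x) conj(ψ_{a,s,t}(x)) dx`. -/
def shearletTransform {n : ℕ} (ψ f : Rn (2 * n) → ℍ[ℝ])
    (z : ℝ × Rn (2 * n - 1) × Rn (2 * n)) : ℍ[ℝ] :=
  ∫ x, f x * star (shearlet ψ z.1 z.2.1 z.2.2 x)

/-- The measure `dμ(a,s,t) = |a|^{-(2n+1)} da ds dt` on `ℝ^* × ℝ^{2n-1} × ℝ^{2n}`, seen as a
measure on `ℝ × ℝ^{2n-1} × ℝ^{2n}` concentrated on `a ≠ 0`. -/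
def haarMeasure (n : ℕ) : Measure (ℝ × Rn (2 * n - 1) × Rn (2 * n)) :=
  (volume.restrict {z | z.1 ≠ 0}).withDensity fun z => ENNReal.ofReal (1 / |z.1| ^ (2 * n + 1))

end QShearlet

end

/-!
The product estimate interpolates between two bounds on a single shearlet transform. The shearlets
`ψ_{a,s,t}` all have the norm of `ψ`, so `|SH_ψ f| ≤ ‖f‖₂ ‖ψ‖₂` pointwise
(`enorm_shearletTransform_le`), and the transform satisfies the energy bound
`‖SH_ψ f‖²_{2,μ} ≤ C_ψ ‖f‖₂²` (`eLpNorm_shearletTransform_le`). Applied to both factors, the first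
gives an `L^∞` bound for the product, the second together with the Cauchy–Schwarz inequality an
`L¹` bound, and `∫ |F|^p ≤ ‖F‖_∞^{p-1} ∫ |F|` gives the theorem.

The energy bound reduces to the complex case. In the splitting `ℍ = ℂ (1 + k) ⊕ ℂ (1 - k)` the
two-sided quaternion Fourier transform is a pair of complex Fourier transforms, one of them composed
with the reflection `(u, v) ↦ (u, -v)` (`qft_ae_eq_join`). Read in these components, the two
identities of the convolution condition say that `ℱ_Q ψ` takes values in `span {1, j}` and that `ψ`
is even in its first `n` variables. Together they force `ψ` itself to take values in the field
`span {1, j} ≅ ℂ` (`ConvCondition.splitQ_ae_eq`). The constant `C_ψ` is then the classical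
admissibility constant of the complex function `η` that `ψ` represents (`admConst_eq`), and writing
`f = f₁ + i f₂` with `f₁, f₂` valued in `span {1, j}` turns `SH_ψ f` into two complex shearlet
transforms, orthogonal in `ℍ`.

For complex functions, `t ↦ SH(a, s, t)` is a correlation, whose energy is at most
`∫ |f̂|² |η̂_{a,s}|²` by Plancherel's formula (`lintegral_correlation_sq_le`). Since
`|η̂_{a,s}(w)|² = |det A_a| |η̂(A_a S_s^T w)|²`, integrating over `(a, s)` amounts to the change of
variables `λ = A_a S_s^T w`, which transports the measure to `|λ_1|^{-2n} dλ` for every `w` with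
`w_1 ≠ 0` (`lintegral_dilation_shear`).

Formulas for the Fourier transform on `L²` are obtained from those for integrable functions by
density (`L2Bounded.ext_of_integrable`).
-/

noncomputable section

namespace QShearlet

/-! ### Bounded additive maps between `L²` spaces of functions -/

/-- A map on functions that is additive and bounded for the `L²` seminorm, all identities being
understood almost everywhere. Working with functions rather than with classes keeps pointwise
formulas such as `f ↦ f ∘ A` readable. -/
structure L2Bounded {α β E F : Type*} [MeasureSpace α] [MeasureSpace β] [NormedAddCommGroup E]
    [NormedAddCommGroup F] (Φ : (α → E) → β → F) : Prop where
  memLp : ∀ f, MemLp f 2 volume → MemLp (Φ f) 2 volume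
  add : ∀ f g, MemLp f 2 volume → MemLp g 2 volume → Φ (f + g) =ᵐ[volume] Φ f + Φ g
  bound : ∃ C : ℝ≥0∞, C ≠ ∞ ∧
    ∀ f, MemLp f 2 volume → eLpNorm (Φ f) 2 volume ≤ C * eLpNorm f 2 volume

namespace L2Bounded

variable {α β γ E F G : Type*} [MeasureSpace α] [MeasureSpace β] [MeasureSpace γ]
  [NormedAddCommGroup E] [NormedAddCommGroup F] [NormedAddCommGroup G]

lemma congr {Φ : (α → E) → β → F} (hΦ : L2Bounded Φ) {f g : α → E} (hf : MemLp f 2 volume)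
    (h : f =ᵐ[volume] g) : Φ f =ᵐ[volume] Φ g := by
  have hg : MemLp g 2 volume := (memLp_congr_ae h).1 hf
  obtain ⟨C, -, hC⟩ := hΦ.bound
  have h0 : eLpNorm (f - g) 2 volume = 0 := by
    rw [eLpNorm_congr_ae (g := 0) (by filter_upwards [h] with x hx; simp [hx]), eLpNorm_zero]
  have h1 : Φ (f - g) =ᵐ[volume] 0 := by
    rw [← eLpNorm_eq_zero_iff (hΦ.memLp _ (hf.sub hg)).1 two_ne_zero]
    have := hC _ (hf.sub hg)
    rw [h0, mul_zero] at this
    exact nonpos_iff_eq_zero.1 this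
  have h2 := hΦ.add (f - g) g (hf.sub hg) hg
  rw [sub_add_cancel] at h2
  filter_upwards [h1, h2] with x hx1 hx2
  simp [hx2, hx1]

/-- Two bounded additive maps that agree on `L¹ ∩ L²` agree on `L²`. -/
lemma ext_of_integrable {Φ Ψ : (α → E) → β → F} (hΦ : L2Bounded Φ) (hΨ : L2Bounded Ψ)
    (h : ∀ f, Integrable f volume → MemLp f 2 volume → Φ f =ᵐ[volume] Ψ f) {f : α → E}
    (hf : MemLp f 2 volume) : Φ f =ᵐ[volume] Ψ f := by
  obtain ⟨C, hC, hCb⟩ := hΦ.bound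
  obtain ⟨D, hD, hDb⟩ := hΨ.bound
  suffices hs : eLpNorm (Φ f - Ψ f) 2 volume = 0 by
    rw [eLpNorm_eq_zero_iff ((hΦ.memLp f hf).1.sub (hΨ.memLp f hf).1) two_ne_zero] at hs
    filter_upwards [hs] with x hx
    exact sub_eq_zero.1 hx
  have key : ∀ ε : ℝ≥0∞, ε ≠ 0 → eLpNorm (Φ f - Ψ f) 2 volume ≤ (C + D) * ε := by
    intro ε hε
    obtain ⟨g, hg, hgm⟩ := hf.exists_simpleFunc_eLpNorm_sub_lt (by norm_num) hε
    have hgi : Integrable g volume :=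
      (SimpleFunc.memLp_iff_integrable (by norm_num) (by norm_num)).1 hgm
    have hd := hf.sub hgm
    have e1 := hΦ.add (f - g) g hd hgm
    have e2 := hΨ.add (f - g) g hd hgm
    rw [sub_add_cancel] at e1 e2
    have e3 : Φ f - Ψ f =ᵐ[volume] Φ (f - g) - Ψ (f - g) := by
      filter_upwards [e1, e2, h g hgi hgm] with x h1 h2 h3
      simp [h1, h2, h3]
    rw [eLpNorm_congr_ae e3, add_mul]
    refine (eLpNorm_sub_le (hΦ.memLp _ hd).1 (hΨ.memLp _ hd).1 (by norm_num)).trans ?_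
    gcongr
    · exact (hCb _ hd).trans (by gcongr)
    · exact (hDb _ hd).trans (by gcongr)
  have hCD : C + D ≠ ∞ := ENNReal.add_ne_top.2 ⟨hC, hD⟩
  by_contra hne
  have hpos : eLpNorm (Φ f - Ψ f) 2 volume ≠ ∞ :=
    ((hΦ.memLp f hf).sub (hΨ.memLp f hf)).2.ne
  set N := eLpNorm (Φ f - Ψ f) 2 volume
  -- the choice of `ε` makes the bound `(C + D) * ε` smaller than `N`
  have h1 := key (N / (2 * (C + D + 1))) (ENNReal.div_ne_zero.2 ⟨hne, by finiteness⟩)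
  have h2 : (C + D) * (N / (2 * (C + D + 1))) ≤ N / 2 := by
    calc (C + D) * (N / (2 * (C + D + 1)))
        ≤ (C + D + 1) * (N / (2 * (C + D + 1))) := mul_le_mul_left le_self_add _
      _ = N / 2 := by
        rw [ENNReal.div_eq_inv_mul, ENNReal.mul_inv (by simp) (by simp), ← mul_assoc,
          mul_left_comm, ENNReal.mul_inv_cancel (by simp) (by finiteness), mul_one,
          ENNReal.div_eq_inv_mul]
  exact absurd (h1.trans h2) (not_le.2 (ENNReal.half_lt_self hne hpos))

lemma comp {Φ : (β → F) → γ → G} {Ψ : (α → E) → β → F} (hΦ : L2Bounded Φ) (hΨ : L2Bounded Ψ) :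
    L2Bounded fun f => Φ (Ψ f) where
  memLp f hf := hΦ.memLp _ (hΨ.memLp f hf)
  add f g hf hg := (hΦ.congr (hΨ.memLp _ (hf.add hg)) (hΨ.add f g hf hg)).trans
    (hΦ.add _ _ (hΨ.memLp f hf) (hΨ.memLp g hg))
  bound := by
    obtain ⟨C, hC, hCb⟩ := hΦ.bound
    obtain ⟨D, hD, hDb⟩ := hΨ.bound
    refine ⟨C * D, ENNReal.mul_ne_top hC hD, fun f hf => ?_⟩
    calc _ ≤ C * eLpNorm (Ψ f) 2 volume := hCb _ (hΨ.memLp f hf)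
      _ ≤ C * (D * eLpNorm f 2 volume) := by gcongr; exact hDb f hf
      _ = _ := (mul_assoc _ _ _).symm

lemma add_map {Φ Ψ : (α → E) → β → F} (hΦ : L2Bounded Φ) (hΨ : L2Bounded Ψ) :
    L2Bounded fun f x => Φ f x + Ψ f x where
  memLp f hf := (hΦ.memLp f hf).add (hΨ.memLp f hf)
  add f g hf hg := by
    filter_upwards [hΦ.add f g hf hg, hΨ.add f g hf hg] with x h1 h2
    simp only [Pi.add_apply] at *
    rw [h1, h2]; abel
  bound := by
    obtain ⟨C, hC, hCb⟩ := hΦ.bound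
    obtain ⟨D, hD, hDb⟩ := hΨ.bound
    refine ⟨C + D, ENNReal.add_ne_top.2 ⟨hC, hD⟩, fun f hf => ?_⟩
    rw [add_mul]
    exact (eLpNorm_add_le (hΦ.memLp _ hf).1 (hΨ.memLp _ hf).1 (by norm_num)).trans
      (add_le_add (hCb f hf) (hDb f hf))

lemma clm [NormedSpace ℝ E] [NormedSpace ℝ F] (L : E →L[ℝ] F) :
    L2Bounded fun (f : α → E) x => L (f x) where
  memLp f hf := L.comp_memLp' hf
  add f g _ _ := Filter.Eventually.of_forall fun x => by simp
  bound := ⟨‖L‖ₑ, by simp, fun f _ => by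
    have := eLpNorm_le_nnreal_smul_eLpNorm_of_ae_le_mul (μ := volume) (f := fun x => L (f x))
      (g := f) (c := ‖L‖₊) (Filter.Eventually.of_forall fun x => L.le_opNNNorm (f x)) 2
    simpa [ENNReal.smul_def, enorm_eq_nnnorm] using this⟩

lemma comp_right {e : β → α} {c : ℝ≥0∞} (he : Measurable e) (hc : c ≠ ∞)
    (h : (volume : Measure β).map e = c • (volume : Measure α)) :
    L2Bounded fun (f : α → E) x => f (e x) where
  memLp f hf := by
    refine MemLp.comp_of_map (f := e) (g := f) ?_ he.aemeasurable
    rw [h]; exact hf.smul_measure hc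
  add f g _ _ := Filter.Eventually.of_forall fun x => rfl
  bound := ⟨c ^ (1 / (2 : ℝ≥0∞)).toReal, by finiteness, fun f hf => by
    have hf' : AEStronglyMeasurable f ((volume : Measure β).map e) := by
      rw [h]; exact hf.1.smul_measure c
    have := eLpNorm_map_measure (p := 2) hf' he.aemeasurable
    rw [h, eLpNorm_smul_measure_of_ne_top (by norm_num)] at this
    exact this.ge⟩

lemma unimodular_mul {u : α → ℂ} (hu : AEStronglyMeasurable u volume) (h1 : ∀ x, ‖u x‖ = 1) :
    L2Bounded fun (f : α → ℂ) x => u x * f x := by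
  have hn : ∀ f : α → ℂ, eLpNorm (fun x => u x * f x) 2 volume = eLpNorm f 2 volume := fun f =>
    eLpNorm_congr_norm_ae (Filter.Eventually.of_forall fun x => by simp [h1])
  refine ⟨fun f hf => ⟨hu.mul hf.1, by rw [hn]; exact hf.2⟩, fun f g _ _ => ?_,
    ⟨1, by simp, fun f _ => by rw [hn, one_mul]⟩⟩
  exact Filter.Eventually.of_forall fun x => by simp [mul_add]

end L2Bounded

/-! ### The Fourier transform of complex square integrable functions -/

open Classical in
/-- The Fourier transform of a square integrable complex function, as a function, with value `0`
for functions that are not square integrable. -/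
def fourierL2 {m : ℕ} (f : Rn m → ℂ) : Rn m → ℂ :=
  if hf : MemLp f 2 volume then
    ((𝓕 (hf.toLp f) : Lp ℂ 2 (volume : Measure (Rn m))) : Rn m → ℂ) else 0

variable {m : ℕ}

lemma fourierL2_eq {f : Rn m → ℂ} (hf : MemLp f 2 volume) :
    fourierL2 f = ((𝓕 (hf.toLp f) : Lp ℂ 2 (volume : Measure (Rn m))) : Rn m → ℂ) :=
  dif_pos hf

lemma stronglyMeasurable_fourierL2 (f : Rn m → ℂ) : StronglyMeasurable (fourierL2 f) := by
  by_cases hf : MemLp f 2 volume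
  · rw [fourierL2_eq hf]; exact Lp.stronglyMeasurable _
  · rw [fourierL2, dif_neg hf]; exact stronglyMeasurable_zero

lemma fourierL2_ae_eq_fourier {f : Rn m → ℂ} (h1 : Integrable f) (h2 : MemLp f 2 volume) :
    fourierL2 f =ᵐ[volume] 𝓕 f := by
  rw [fourierL2_eq h2]; exact fourier_toLp_ae h1 h2

lemma eLpNorm_fourierL2 {f : Rn m → ℂ} (hf : MemLp f 2 volume) :
    eLpNorm (fourierL2 f) 2 volume = eLpNorm f 2 volume := by
  rw [fourierL2_eq hf, ← eLpNorm_congr_ae hf.coeFn_toLp, ← Lp.enorm_def, ← Lp.enorm_def,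
    enorm_eq_iff_norm_eq]
  exact Lp.norm_fourier_eq _

lemma memLp_fourierL2 {f : Rn m → ℂ} (hf : MemLp f 2 volume) : MemLp (fourierL2 f) 2 volume := by
  rw [fourierL2_eq hf]; exact Lp.memLp _

lemma fourierL2_add {f g : Rn m → ℂ} (hf : MemLp f 2 volume) (hg : MemLp g 2 volume) :
    fourierL2 (f + g) =ᵐ[volume] fourierL2 f + fourierL2 g := by
  rw [fourierL2_eq hf, fourierL2_eq hg, fourierL2_eq (hf.add hg), MemLp.toLp_add hf hg,
    FourierTransform.fourier_add]
  exact Lp.coeFn_add _ _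

lemma l2Bounded_fourierL2 : L2Bounded (fourierL2 : (Rn m → ℂ) → Rn m → ℂ) where
  memLp _ hf := memLp_fourierL2 hf
  add _ _ hf hg := fourierL2_add hf hg
  bound := ⟨1, by simp, fun f hf => by rw [eLpNorm_fourierL2 hf, one_mul]⟩

lemma fourierL2_smul (c : ℂ) {f : Rn m → ℂ} (hf : MemLp f 2 volume) :
    fourierL2 (fun x => c * f x) =ᵐ[volume] fun w => c * fourierL2 f w := by
  have h := MemLp.toLp_const_smul c hf
  have e : (fun x => c * f x) = c • f := rfl
  rw [e, fourierL2_eq (hf.const_smul c), fourierL2_eq hf, h, FourierTransform.fourier_smul]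
  exact Lp.coeFn_smul _ _

lemma ae_eq_of_fourierL2_ae_eq {f g : Rn m → ℂ} (hf : MemLp f 2 volume) (hg : MemLp g 2 volume)
    (h : fourierL2 f =ᵐ[volume] fourierL2 g) : f =ᵐ[volume] g := by
  have e := fourierL2_add (hf.sub hg) hg
  rw [sub_add_cancel] at e
  have h0 : eLpNorm (fourierL2 (f - g)) 2 volume = 0 := by
    rw [eLpNorm_congr_ae (g := 0), eLpNorm_zero]
    filter_upwards [e, h] with x h1 h2
    simp only [Pi.add_apply, Pi.zero_apply] at *
    rw [h2] at h1
    exact left_eq_add.1 (by rw [add_comm]; exact h1)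
  rw [eLpNorm_fourierL2 (hf.sub hg), eLpNorm_eq_zero_iff (hf.sub hg).1 two_ne_zero] at h0
  filter_upwards [h0] with x hx
  exact sub_eq_zero.1 hx

/-- Parseval's formula. -/
lemma integral_mul_conj_fourierL2 {f g : Rn m → ℂ} (hf : MemLp f 2 volume)
    (hg : MemLp g 2 volume) :
    ∫ x, f x * star (g x) = ∫ w, fourierL2 f w * star (fourierL2 g w) := by
  have h := Lp.inner_fourier_eq (hg.toLp g) (hf.toLp f)
  rw [L2.inner_def, L2.inner_def, ← fourierL2_eq, ← fourierL2_eq] at h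
  simp only [RCLike.inner_apply] at h
  refine Eq.trans ?_ h.symm
  refine integral_congr_ae ?_
  filter_upwards [hf.coeFn_toLp, hg.coeFn_toLp] with x h1 h2
  rw [h1, h2]; rfl

lemma l2Bounded_star : L2Bounded fun (f : Rn m → ℂ) x => star (f x) :=
  L2Bounded.clm (Complex.conjCLE : ℂ →L[ℝ] ℂ)

lemma l2Bounded_neg {E : Type*} [NormedAddCommGroup E] :
    L2Bounded fun (f : Rn m → E) x => f (-x) :=
  L2Bounded.comp_right (c := 1) measurable_neg (by simp)
    (by rw [one_smul]; exact (Measure.measurePreserving_neg volume).map_eq)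

lemma fourierL2_star {f : Rn m → ℂ} (hf : MemLp f 2 volume) :
    fourierL2 (fun x => star (f x)) =ᵐ[volume] fun w => star (fourierL2 f (-w)) := by
  refine L2Bounded.ext_of_integrable (Φ := fun f => fourierL2 (fun x => star (f x)))
    (Ψ := fun f w => star (fourierL2 f (-w))) (l2Bounded_fourierL2.comp l2Bounded_star)
    (l2Bounded_star.comp (l2Bounded_neg.comp l2Bounded_fourierL2)) (fun f h1 h2 => ?_) hf
  have h3 : Integrable fun x => star (f x) :=
    (Complex.conjCLE : ℂ →L[ℝ] ℂ).integrable_comp h1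
  have e := (Measure.measurePreserving_neg (volume : Measure (Rn m))).quasiMeasurePreserving.ae_eq
    (fourierL2_ae_eq_fourier h1 h2)
  filter_upwards [fourierL2_ae_eq_fourier h3 (l2Bounded_star.memLp f h2), e] with w h4 h5
  simp only [Function.comp_apply] at h5
  rw [h4, h5, fourier_eq_exp, fourier_eq_exp]
  refine Eq.trans ?_ (integral_conj (𝕜 := ℂ))
  refine integral_congr_ae (Filter.Eventually.of_forall fun x => ?_)
  beta_reduce
  rw [map_mul, Complex.star_def, ← Complex.exp_conj, map_mul,
    Complex.conj_ofReal, Complex.conj_I]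
  simp

lemma fourierL2_neg {f : Rn m → ℂ} (hf : MemLp f 2 volume) :
    fourierL2 (fun x => f (-x)) =ᵐ[volume] fun w => fourierL2 f (-w) := by
  refine L2Bounded.ext_of_integrable (Φ := fun f => fourierL2 (fun x => f (-x)))
    (Ψ := fun f w => fourierL2 f (-w)) (l2Bounded_fourierL2.comp l2Bounded_neg)
    (l2Bounded_neg.comp l2Bounded_fourierL2) (fun f h1 h2 => ?_) hf
  have e := (Measure.measurePreserving_neg (volume : Measure (Rn m))).quasiMeasurePreserving.ae_eq
    (fourierL2_ae_eq_fourier h1 h2)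
  filter_upwards [fourierL2_ae_eq_fourier h1.comp_neg (l2Bounded_neg.memLp f h2), e] with w h4 h5
  simp only [Function.comp_apply] at h5
  rw [h4, h5, fourier_eq_exp, fourier_eq_exp, ← integral_neg_eq_self]
  refine integral_congr_ae (Filter.Eventually.of_forall fun x => ?_)
  simp

lemma l2Bounded_translate {E : Type*} [NormedAddCommGroup E] (t : Rn m) :
    L2Bounded fun (f : Rn m → E) x => f (x - t) :=
  L2Bounded.comp_right (c := 1) (measurable_id.sub_const t) (by simp)
    (by rw [one_smul]; exact (measurePreserving_sub_right volume t).map_eq)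

lemma fourierL2_translate (t : Rn m) {f : Rn m → ℂ} (hf : MemLp f 2 volume) :
    fourierL2 (fun x => f (x - t)) =ᵐ[volume] fun w =>
      Complex.exp ((-(2 * Real.pi * inner ℝ t w) : ℝ) * Complex.I) * fourierL2 f w := by
  refine L2Bounded.ext_of_integrable (Φ := fun f => fourierL2 (fun x => f (x - t)))
    (l2Bounded_fourierL2.comp (l2Bounded_translate t))
    ((L2Bounded.unimodular_mul (Continuous.aestronglyMeasurable (by fun_prop)) fun x =>
      Complex.norm_exp_ofReal_mul_I _).comp l2Bounded_fourierL2) (fun f h1 h2 => ?_) hf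
  filter_upwards [fourierL2_ae_eq_fourier (h1.comp_sub_right t)
    ((l2Bounded_translate t).memLp f h2), fourierL2_ae_eq_fourier h1 h2] with w h4 h5
  rw [h4, h5, fourier_eq_exp, fourier_eq_exp, ← integral_add_right_eq_self _ t,
    ← integral_const_mul]
  refine integral_congr_ae (Filter.Eventually.of_forall fun x => ?_)
  beta_reduce
  rw [add_sub_cancel_right, ← mul_assoc, ← Complex.exp_add, inner_add_left]
  congr 2
  push_cast; ring

/-- The Fourier transform of a linear change of variables; `L'` is the adjoint of `L`. -/
lemma fourierL2_comp_symm (L L' : Rn m ≃L[ℝ] Rn m)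
    (hL : ∀ x w, inner ℝ (L x) w = inner ℝ x (L' w)) {f : Rn m → ℂ} (hf : MemLp f 2 volume) :
    fourierL2 (fun x => f (L.symm x)) =ᵐ[volume] fun w =>
      ((|LinearMap.det (L : Rn m →ₗ[ℝ] Rn m)| : ℝ) : ℂ) * fourierL2 f (L' w) := by
  have hmap : ∀ A : Rn m ≃L[ℝ] Rn m, (volume : Measure (Rn m)).map A =
      ENNReal.ofReal |(LinearMap.det (A : Rn m →ₗ[ℝ] Rn m))⁻¹| • volume := fun A =>
    Measure.map_linearMap_addHaar_eq_smul_addHaar (f := (A : Rn m →ₗ[ℝ] Rn m)) volume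
      (LinearEquiv.isUnit_det' A.toLinearEquiv).ne_zero
  have hcomp : ∀ A : Rn m ≃L[ℝ] Rn m, L2Bounded fun (f : Rn m → ℂ) x => f (A x) := fun A =>
    L2Bounded.comp_right A.continuous.measurable ENNReal.ofReal_ne_top (hmap A)
  refine L2Bounded.ext_of_integrable (Φ := fun f => fourierL2 (fun x => f (L.symm x)))
    (l2Bounded_fourierL2.comp (hcomp L.symm))
    ((L2Bounded.clm (ContinuousLinearMap.mul ℝ ℂ _)).comp
      ((hcomp L').comp l2Bounded_fourierL2)) (fun f h1 h2 => ?_) hf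
  have hdet : LinearMap.det (L : Rn m →ₗ[ℝ] Rn m) ≠ 0 :=
    (LinearEquiv.isUnit_det' L.toLinearEquiv).ne_zero
  have hi : Integrable fun x => f (L.symm x) := by
    have : Integrable f ((volume : Measure (Rn m)).map L.symm) := by
      rw [hmap]; exact h1.smul_measure ENNReal.ofReal_ne_top
    exact this.comp_measurable L.symm.continuous.measurable
  have hq : Measure.QuasiMeasurePreserving L' volume volume :=
    ⟨L'.continuous.measurable, by rw [hmap]; exact Measure.smul_absolutelyContinuous⟩
  filter_upwards [fourierL2_ae_eq_fourier hi ((hcomp L.symm).memLp f h2),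
    hq.ae_eq (fourierL2_ae_eq_fourier h1 h2)] with w h4 h5
  simp only [Function.comp_apply] at h5
  rw [h4, ContinuousLinearMap.mul_apply', h5, fourier_eq_exp, fourier_eq_exp]
  have hv : (volume : Measure (Rn m)) =
      ENNReal.ofReal |LinearMap.det (L : Rn m →ₗ[ℝ] Rn m)| • (volume : Measure (Rn m)).map L := by
    rw [hmap, smul_smul, ← ENNReal.ofReal_mul (abs_nonneg _), ← abs_mul, mul_inv_cancel₀ hdet]
    simp
  conv_lhs => rw [hv]
  rw [integral_smul_measure, ENNReal.toReal_ofReal (abs_nonneg _),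
    (show MeasurableEmbedding L from L.toHomeomorph.measurableEmbedding).integral_map]
  simp [hL]

variable {n : ℕ}

/-! ### The quaternion Fourier transform in the splitting `ℍ = ℂ (1 + k) ⊕ ℂ (1 - k)` -/

lemma splitP_join (z w : ℂ) : splitP (joinP z + joinQ w) = z := by
  apply Complex.ext <;> simp [joinP_apply, joinQ_apply, splitP_apply]
  ring

lemma splitQ_join (z w : ℂ) : splitQ (joinP z + joinQ w) = w := by
  apply Complex.ext <;> simp [joinP_apply, joinQ_apply, splitQ_apply]
  ring

lemma norm_qftL2_le (f : Lp ℍ[ℝ] 2 (volume : Measure (Rn (2 * n)))) : ‖qftL2 n f‖ ≤ 1 * ‖f‖ := by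
  refine ((qftL2 n).le_opNorm f).trans (mul_le_mul_of_nonneg_right ?_ (norm_nonneg f))
  exact LinearMap.opNorm_extendOfNorm_le (dense_L1L2 n) zero_le_one
    fun x => by rw [one_mul]; exact (norm_qftL1L2 x).le

lemma l2Bounded_qft : L2Bounded (qft : (Rn (2 * n) → ℍ[ℝ]) → Rn (2 * n) → ℍ[ℝ]) where
  memLp f hf := by rw [qft, dif_pos hf]; exact Lp.memLp _
  add f g hf hg := by
    rw [qft, qft, qft, dif_pos hf, dif_pos hg, dif_pos (hf.add hg), MemLp.toLp_add hf hg, map_add]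
    exact Lp.coeFn_add _ _
  bound := ⟨1, by simp, fun f hf => by
    rw [qft, dif_pos hf, one_mul]
    conv_rhs => rw [← eLpNorm_congr_ae hf.coeFn_toLp]
    rw [← Lp.enorm_def, ← Lp.enorm_def, enorm_le_iff_norm_le]
    simpa using norm_qftL2_le (hf.toLp f)⟩

lemma qft_congr {f g : Rn (2 * n) → ℍ[ℝ]} (h : f =ᵐ[volume] g) : qft f = qft g := by
  by_cases hf : MemLp f 2 volume
  · have hg := (memLp_congr_ae h).1 hf
    rw [qft, qft, dif_pos hf, dif_pos hg, MemLp.toLp_congr hf hg h]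
  · have hg := (memLp_congr_ae h).not.1 hf
    rw [qft, qft, dif_neg hf, dif_neg hg]

lemma l2Bounded_reflY {E : Type*} [NormedAddCommGroup E] :
    L2Bounded fun (f : Rn (2 * n) → E) x => f (reflY n x) :=
  L2Bounded.comp_right (c := 1) (reflY n).continuous.measurable (by simp)
    (by rw [one_smul]; exact (reflY n).measurePreserving.map_eq)

/-- The two-sided transform is a pair of complex Fourier transforms, one of them reflected. -/
lemma qft_ae_eq_join {f : Rn (2 * n) → ℍ[ℝ]} (hf : MemLp f 2 volume) :
    qft f =ᵐ[volume] fun w => joinP (fourierL2 (fun x => splitP (f x)) (reflY n w)) +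
      joinQ (fourierL2 (fun x => splitQ (f x)) w) := by
  refine L2Bounded.ext_of_integrable l2Bounded_qft
    (((L2Bounded.clm joinP).comp (l2Bounded_reflY.comp
      (l2Bounded_fourierL2.comp (L2Bounded.clm splitP)))).add_map
      ((L2Bounded.clm joinQ).comp (l2Bounded_fourierL2.comp (L2Bounded.clm splitQ))))
    (fun f h1 h2 => ?_) hf
  have eP := (reflY n).measurePreserving.quasiMeasurePreserving.ae_eq
    (fourierL2_ae_eq_fourier (splitP.integrable_comp h1) (splitP.comp_memLp' h2))
  filter_upwards [qft_ae_eq h1 h2, eP,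
    fourierL2_ae_eq_fourier (splitQ.integrable_comp h1) (splitQ.comp_memLp' h2)] with w h3 h4 h5
  simp only [Function.comp_apply] at h4
  rw [h3, h4, h5, qftIntegral_eq h1]

/-! ### The convolution condition -/

lemma splitP_qj_mul (q : ℍ[ℝ]) : splitP (qj * q) = -Complex.I * star (splitQ q) := by
  apply Complex.ext <;> simp [splitP_apply, splitQ_apply] <;> ring

lemma reflY_reflY (w : Rn (2 * n)) : reflY n (reflY n w) = w := by
  ext k
  simp only [reflY, LinearIsometryEquiv.piLpCongrRight_apply]
  split_ifs <;> simp

/-- A quaternion that commutes with `e^{jθ}`, `sin θ ≠ 0`, lies in `span {1, j}`. -/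
lemma splitQ_eq_star_splitP_of_commute {q : ℍ[ℝ]} {θ : ℝ} (hθ : Real.sin θ ≠ 0)
    (h : q * expJ θ = expJ θ * q) : splitQ q = star (splitP q) := by
  rw [expJ_eq] at h
  have h1 := congrArg (fun q => q.imI) h
  have h3 := congrArg (fun q => q.imK) h
  simp at h1 h3
  have e1 : q.imK = 0 := by
    have : Real.sin θ * q.imK = 0 := by linarith
    simpa [hθ] using this
  have e3 : q.imI = 0 := by
    have : Real.sin θ * q.imI = 0 := by linarith
    simpa [hθ] using this
  apply Complex.ext <;> simp [splitP_apply, splitQ_apply, e1, e3, neg_div]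

lemma ae_coord_ne_zero {m : ℕ} (k : Fin m) : ∀ᵐ w : Rn m, w k ≠ 0 := by
  let L : Rn m →L[ℝ] ℝ := EuclideanSpace.proj k
  have h : (volume : Measure (Rn m)) (LinearMap.ker (L : Rn m →ₗ[ℝ] ℝ)) = 0 := by
    refine Measure.addHaar_submodule _ _ fun h => ?_
    have h0 : EuclideanSpace.single k (1 : ℝ) ∈ LinearMap.ker (L : Rn m →ₗ[ℝ] ℝ) := by
      rw [h]; trivial
    have h1 : L (EuclideanSpace.single k (1 : ℝ)) = 1 := by simp [L]
    rw [LinearMap.mem_ker] at h0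
    exact one_ne_zero (h1.symm.trans h0)
  filter_upwards [measure_eq_zero_iff_ae_notMem.1 h] with w hw h0
  exact hw h0

/-- Almost every `w = (u, v)` has `v ≠ 0`. -/
lemma ae_sndHalf_ne_zero [NeZero n] : ∀ᵐ w : Rn (2 * n), sndHalf w ≠ 0 := by
  have hn : 0 < n := Nat.pos_of_ne_zero (NeZero.ne n)
  filter_upwards [ae_coord_ne_zero (⟨n, by omega⟩ : Fin (2 * n))] with w hw h0
  exact hw (congrArg (fun v : Rn n => v ⟨0, hn⟩) h0)

/-- The convolution condition forces `h` to take its values in the field `span {1, j}`: its first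
half says that the transform of `h` does, its second half that `h` is even in the first `n`
variables, and together they give that `h` itself does. -/
lemma ConvCondition.splitQ_ae_eq [NeZero n] {h : Rn (2 * n) → ℍ[ℝ]} (hh : ConvCondition h)
    (hm : MemLp h 2 volume) :
    (fun x => splitQ (h x)) =ᵐ[volume] fun x => star (splitP (h x)) := by
  set P := fun x => splitP (h x) with hP
  set Q := fun x => splitQ (h x) with hQ
  have hPm : MemLp P 2 volume := splitP.comp_memLp' hm
  have hQm : MemLp Q 2 volume := splitQ.comp_memLp' hm
  have hjm : MemLp (fun x => qj * h x) 2 volume :=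
    (ContinuousLinearMap.mul ℝ ℍ[ℝ] qj).comp_memLp' hm
  have qR := (reflY n).measurePreserving.quasiMeasurePreserving
  have qN := (Measure.measurePreserving_neg
    (volume : Measure (Rn (2 * n)))).quasiMeasurePreserving
  have hA : ∀ᵐ w, fourierL2 Q w = star (fourierL2 P (reflY n w)) := by
    filter_upwards [hh, ae_sndHalf_ne_zero, qft_ae_eq_join hm] with w hw hv he
    -- a translation `t` along `v` for which the exponential is `e^{-jπ/2}`
    have ht := (hw ((1 / (4 * ‖sndHalf w‖ ^ 2)) • sndHalf w)).1
    have hθ : 2 * Real.pi * inner ℝ (sndHalf w) ((1 / (4 * ‖sndHalf w‖ ^ 2)) • sndHalf w) =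
        Real.pi / 2 := by
      have : ‖sndHalf w‖ ≠ 0 := norm_ne_zero_iff.2 hv
      rw [inner_smul_right, real_inner_self_eq_norm_sq]
      field_simp; norm_num
    rw [hθ] at ht
    have := splitQ_eq_star_splitP_of_commute (by simp) ht
    rwa [he, splitQ_join, splitP_join] at this
  have hB : ∀ᵐ w, fourierL2 Q (-reflY n w) = fourierL2 Q w := by
    have e1 : (fun x => splitP (qj * h x)) = fun x => -Complex.I * star (Q x) :=
      funext fun x => splitP_qj_mul _
    filter_upwards [hh, qft_ae_eq_join hm, qft_ae_eq_join hjm,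
      qR.ae (fourierL2_smul (-Complex.I) (l2Bounded_star.memLp Q hQm)),
      qR.ae (fourierL2_star hQm)] with w hw he hej h3 h4
    have ht := (hw 0).2
    have hexp : expJ 0 = 1 := by simp [expJ]
    rw [inner_zero_right, mul_zero, neg_zero, hexp, mul_one, mul_one, hej, he] at ht
    have h5 := congrArg splitP ht
    rw [splitP_join, splitP_qj_mul, splitQ_join, e1, h3, h4] at h5
    have h6 := star_injective (mul_left_cancel₀ (neg_ne_zero.2 Complex.I_ne_zero) h5)
    exact h6
  refine ae_eq_of_fourierL2_ae_eq hQm (l2Bounded_star.memLp P hPm) ?_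
  filter_upwards [hB, qR.ae (qN.ae hA), fourierL2_star hPm] with w h1 h2 h3
  rw [h3, ← h1, h2, map_neg, reflY_reflY]

/-! ### Quaternions as pairs over the field `span {1, j}` -/

/-- The embedding `x + y i ↦ x + y j` of `ℂ` onto the subfield `span {1, j}` of `ℍ`. -/
def ofC : ℂ →L[ℝ] ℍ[ℝ] := Complex.reCLM.smulRight 1 + Complex.imCLM.smulRight qj

/-- The map `x + y i ↦ i (x + y j)` of `ℂ` onto the complement `span {i, k}` of `span {1, j}`. -/
def ofC' : ℂ →L[ℝ] ℍ[ℝ] := Complex.reCLM.smulRight qi + Complex.imCLM.smulRight (qi * qj)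

/-- The coordinate of a quaternion along `ofC`. -/
def toC : ℍ[ℝ] →L[ℝ] ℂ := LinearMap.toContinuousLinearMap
  { toFun := fun q => ⟨q.re, q.imJ⟩
    map_add' := fun a b => by apply Complex.ext <;> simp
    map_smul' := fun r a => by apply Complex.ext <;> simp }

/-- The coordinate of a quaternion along `ofC'`. -/
def toC' : ℍ[ℝ] →L[ℝ] ℂ := LinearMap.toContinuousLinearMap
  { toFun := fun q => ⟨q.imI, q.imK⟩
    map_add' := fun a b => by apply Complex.ext <;> simp
    map_smul' := fun r a => by apply Complex.ext <;> simp }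

lemma ofC_apply (z : ℂ) : ofC z = z.re • 1 + z.im • qj := rfl
lemma ofC'_apply (z : ℂ) : ofC' z = z.re • qi + z.im • (qi * qj) := rfl
lemma toC_apply (q : ℍ[ℝ]) : toC q = ⟨q.re, q.imJ⟩ := rfl
lemma toC'_apply (q : ℍ[ℝ]) : toC' q = ⟨q.imI, q.imK⟩ := rfl

lemma ofC_toC_add (q : ℍ[ℝ]) : ofC (toC q) + ofC' (toC' q) = q := by
  ext <;> simp [ofC_apply, ofC'_apply, toC_apply, toC'_apply]

lemma enorm_sq_ofC_add (z w : ℂ) : ‖ofC z + ofC' w‖ₑ ^ 2 = ‖z‖ₑ ^ 2 + ‖w‖ₑ ^ 2 := by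
  have h : ‖ofC z + ofC' w‖ ^ 2 = ‖z‖ ^ 2 + ‖w‖ ^ 2 := by
    rw [norm_sq_eq, Complex.sq_norm, Complex.sq_norm, Complex.normSq_apply, Complex.normSq_apply]
    simp [ofC_apply, ofC'_apply]
    ring
  have h' : ‖ofC z + ofC' w‖₊ ^ 2 = ‖z‖₊ ^ 2 + ‖w‖₊ ^ 2 := by
    apply NNReal.eq; push_cast; exact h
  simp only [enorm_eq_nnnorm]
  exact_mod_cast h'

lemma mul_star_ofC (q : ℍ[ℝ]) (z : ℂ) :
    q * star (ofC z) = ofC (toC q * star z) + ofC' (toC' q * star z) := by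
  ext <;> simp [ofC_apply, ofC'_apply, toC_apply, toC'_apply]

lemma ofC_toC_of_splitQ {q : ℍ[ℝ]} (h : splitQ q = star (splitP q)) : ofC (toC q) = q := by
  have h1 := congrArg Complex.re h
  have h2 := congrArg Complex.im h
  simp [splitP_apply, splitQ_apply] at h1 h2
  have e1 : q.imK = 0 := by linarith
  have e2 : q.imI = 0 := by linarith
  ext <;> simp [ofC_apply, toC_apply, e1, e2]

lemma splitP_star_ofC (z : ℂ) : splitP (star (ofC z)) = (2⁻¹ : ℂ) * z := by
  apply Complex.ext <;> simp [splitP_apply, ofC_apply, div_eq_inv_mul]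

lemma splitQ_star_ofC (z : ℂ) : splitQ (star (ofC z)) = (2⁻¹ : ℂ) * star z := by
  apply Complex.ext <;> simp [splitQ_apply, ofC_apply, div_eq_inv_mul]

/-! ### The admissibility constant -/

lemma enorm_star_eq {E : Type*} [SeminormedAddCommGroup E] [StarAddMonoid E] [NormedStarGroup E]
    (x : E) : ‖star x‖ₑ = ‖x‖ₑ := by
  simp [enorm_eq_nnnorm]

lemma eLpNorm_two_sq {α E : Type*} [MeasurableSpace α] [NormedAddCommGroup E] (f : α → E)
    (μ : Measure α) : eLpNorm f 2 μ ^ 2 = ∫⁻ x, ‖f x‖ₑ ^ 2 ∂μ := by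
  have k := eLpNorm_nnreal_pow_eq_lintegral (f := f) (μ := μ) (p := 2) (by norm_num)
  simpa only [NNReal.coe_ofNat, ENNReal.rpow_ofNat, ENNReal.coe_ofNat] using k

lemma lintegral_fourierL2_sq {f : Rn m → ℂ} (hf : MemLp f 2 volume) :
    ∫⁻ w, ‖fourierL2 f w‖ₑ ^ 2 = ∫⁻ x, ‖f x‖ₑ ^ 2 := by
  rw [← eLpNorm_two_sq, ← eLpNorm_two_sq, eLpNorm_fourierL2 hf]

lemma abs_reflY (w : Rn (2 * n)) (k : Fin (2 * n)) : |reflY n w k| = |w k| := by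
  simp only [reflY, LinearIsometryEquiv.piLpCongrRight_apply]
  split_ifs <;> simp

/-- For functions with values in `span {1, j}` the admissibility constant is the classical one. -/
lemma admConst_eq [NeZero n] {ψ : Rn (2 * n) → ℍ[ℝ]} {η : Rn (2 * n) → ℂ}
    (hη : MemLp η 2 volume) (h : ψ =ᵐ[volume] fun x => ofC (η x)) :
    admConst ψ =
      ∫⁻ w : Rn (2 * n), ‖fourierL2 η w‖ₑ ^ 2 * ENNReal.ofReal (1 / |w 0| ^ (2 * n)) := by
  have mN := Measure.measurePreserving_neg (volume : Measure (Rn (2 * n)))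
  have mR := (reflY n).measurePreserving
  have qN := mN.quasiMeasurePreserving
  have qR := mR.quasiMeasurePreserving
  have hηN : MemLp (fun x => η (-x)) 2 volume := l2Bounded_neg.memLp η hη
  have hs : starRefl ψ =ᵐ[volume] fun x => star (ofC (η (-x))) := by
    filter_upwards [qN.ae h] with x hx
    rw [starRefl, hx]
  have hsm : MemLp (fun x => star (ofC (η (-x)))) 2 volume :=
    (ofC.comp_memLp' hηN).star
  have hP : (fun x => splitP (star (ofC (η (-x))))) = fun x => (2⁻¹ : ℂ) * η (-x) :=
    funext fun x => splitP_star_ofC _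
  have hQ : (fun x => splitQ (star (ofC (η (-x))))) = fun x => (2⁻¹ : ℂ) * star (η (-x)) :=
    funext fun x => splitQ_star_ofC _
  -- the weight is even and invariant under the reflection, so both halves have the same integral
  have key : ∀ᵐ w, ENNReal.ofReal (‖qft (starRefl ψ) w‖ ^ 2 / |w 0| ^ (2 * n)) =
      2⁻¹ * (‖fourierL2 η (-reflY n w)‖ₑ ^ 2 * ENNReal.ofReal (1 / |(-reflY n w) 0| ^ (2 * n))) +
      2⁻¹ * (‖fourierL2 η w‖ₑ ^ 2 * ENNReal.ofReal (1 / |w 0| ^ (2 * n))) := by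
    rw [qft_congr hs]
    filter_upwards [qft_ae_eq_join hsm, qR.ae (fourierL2_smul 2⁻¹ hηN),
      fourierL2_smul 2⁻¹ (l2Bounded_star.memLp _ hηN), qR.ae (fourierL2_neg hη),
      fourierL2_star hηN, qN.ae (fourierL2_neg hη)] with w h0 h1 h2 h3 h4 h5
    have e : ‖qft (fun x => star (ofC (η (-x)))) w‖ₑ ^ 2 =
        2⁻¹ * ‖fourierL2 η (-reflY n w)‖ₑ ^ 2 + 2⁻¹ * ‖fourierL2 η w‖ₑ ^ 2 := by
      have c2 : (2 : ℝ≥0∞) * (2⁻¹ ^ 2) = 2⁻¹ := by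
        rw [pow_two, ← mul_assoc, ENNReal.mul_inv_cancel two_ne_zero ENNReal.ofNat_ne_top, one_mul]
      have c3 : ‖(2⁻¹ : ℂ)‖ₑ = 2⁻¹ := by
        rw [enorm_inv two_ne_zero]
        congr 1
        rw [← ofReal_norm]; simp
      rw [h0, norm_sq_join, hP, hQ, h1, h2, h3, h4, h5, neg_neg, enorm_mul, enorm_mul, c3,
        mul_pow, mul_pow, ← mul_assoc, ← mul_assoc, c2]
      congr 3
      exact enorm_star_eq _
    rw [div_eq_mul_one_div, ENNReal.ofReal_mul (by positivity), ENNReal.ofReal_pow (norm_nonneg _),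
      ofReal_norm, e, add_mul, mul_assoc, mul_assoc]
    simp only [PiLp.neg_apply, abs_neg, abs_reflY]
  have hm : Measurable fun w : Rn (2 * n) =>
      ‖fourierL2 η w‖ₑ ^ 2 * ENNReal.ofReal (1 / |w 0| ^ (2 * n)) :=
    ((stronglyMeasurable_fourierL2 η).enorm.pow_const 2).mul (by fun_prop)
  have hI : ∫⁻ w, ‖fourierL2 η (-reflY n w)‖ₑ ^ 2 *
      ENNReal.ofReal (1 / |(-reflY n w) 0| ^ (2 * n)) =
        ∫⁻ w : Rn (2 * n), ‖fourierL2 η w‖ₑ ^ 2 * ENNReal.ofReal (1 / |w 0| ^ (2 * n)) :=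
    (mN.comp mR).lintegral_comp hm
  rw [admConst, lintegral_congr_ae key, lintegral_add_right _ (hm.const_mul _),
    lintegral_const_mul' _ _ (by simp), lintegral_const_mul' _ _ (by simp), hI, ← add_mul,
    ENNReal.inv_two_add_inv_two, one_mul]

/-! ### Correlations of square integrable functions -/

lemma integrable_mul_star {f g : Rn m → ℂ} (hf : MemLp f 2 volume) (hg : MemLp g 2 volume) :
    Integrable fun x => f x * star (g x) :=
  MemLp.integrable_mul hf (l2Bounded_star.memLp g hg)

/-- The correlation of `f` and `h` is the inverse Fourier transform of `f̂ * conj ĥ`. -/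
lemma correlation_eq_fourier {f h : Rn m → ℂ} (hf : MemLp f 2 volume) (hh : MemLp h 2 volume)
    (t : Rn m) : ∫ x, f x * star (h (x - t)) =
      𝓕 (fun w => fourierL2 f w * star (fourierL2 h w)) (-t) := by
  rw [integral_mul_conj_fourierL2 hf ((l2Bounded_translate t).memLp h hh), fourier_eq_exp]
  refine integral_congr_ae ?_
  filter_upwards [fourierL2_translate t hh] with w hw
  rw [hw, star_mul', Complex.star_def, ← Complex.exp_conj, map_mul,
    Complex.conj_ofReal, Complex.conj_I, inner_neg_right, real_inner_comm]
  push_cast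
  ring_nf

lemma continuous_correlation {f h : Rn m → ℂ} (hf : MemLp f 2 volume) (hh : MemLp h 2 volume) :
    Continuous fun t => ∫ x, f x * star (h (x - t)) := by
  simp only [correlation_eq_fourier hf hh]
  exact (VectorFourier.fourierIntegral_continuous Real.continuous_fourierChar
    (by exact continuous_inner) (integrable_mul_star (memLp_fourierL2 hf)
      (memLp_fourierL2 hh))).comp continuous_neg

/-- The `L²` norm of a correlation is controlled by the Fourier transforms. Both sides may be
infinite. -/
lemma lintegral_correlation_sq_le {f h : Rn m → ℂ} (hf : MemLp f 2 volume)
    (hh : MemLp h 2 volume) :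
    ∫⁻ t, ‖∫ x, f x * star (h (x - t))‖ₑ ^ 2 ≤
      ∫⁻ w, ‖fourierL2 f w‖ₑ ^ 2 * ‖fourierL2 h w‖ₑ ^ 2 := by
  simp only [correlation_eq_fourier hf hh]
  set G : Rn m → ℂ := fun w => fourierL2 f w * star (fourierL2 h w) with hG
  have hGi : Integrable G := integrable_mul_star (memLp_fourierL2 hf) (memLp_fourierL2 hh)
  have hGn : ∀ w, ‖G w‖ₑ ^ 2 = ‖fourierL2 f w‖ₑ ^ 2 * ‖fourierL2 h w‖ₑ ^ 2 := fun w => by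
    rw [hG, ← mul_pow, enorm_mul, enorm_star_eq]
  simp only [← hGn]
  by_cases hG2 : MemLp G 2 volume
  · rw [(Measure.measurePreserving_neg (volume : Measure (Rn m))).lintegral_comp_emb
      (MeasurableEquiv.neg _).measurableEmbedding (fun t => ‖𝓕 G t‖ₑ ^ 2)]
    exact (lintegral_sq_fourier hGi hG2).le
  · -- here the right-hand side is infinite
    have : eLpNorm G 2 volume = ∞ := by
      by_contra hne
      exact hG2 ⟨hGi.1, lt_top_iff_ne_top.2 hne⟩
    rw [← eLpNorm_two_sq G, this]
    simp

/-! ### Linear changes of variables given by matrices -/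

/-- The action of an invertible matrix on Euclidean space. -/
def matrixEquiv (M : Matrix (Fin m) (Fin m) ℝ) (hM : IsUnit M.det) : Rn m ≃L[ℝ] Rn m :=
  LinearEquiv.toContinuousLinearEquiv
    { toFun := fun x => WithLp.toLp 2 (M *ᵥ x.ofLp)
      map_add' := fun x y => by simp [Matrix.mulVec_add]
      map_smul' := fun c x => by simp [Matrix.mulVec_smul]
      invFun := fun x => WithLp.toLp 2 (M⁻¹ *ᵥ x.ofLp)
      left_inv := fun x => by simp [Matrix.nonsing_inv_mul _ hM]
      right_inv := fun x => by simp [Matrix.mul_nonsing_inv _ hM] }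

lemma matrixEquiv_apply (M : Matrix (Fin m) (Fin m) ℝ) (hM : IsUnit M.det) (x : Rn m) :
    matrixEquiv M hM x = WithLp.toLp 2 (M *ᵥ x.ofLp) := rfl

lemma det_matrixEquiv (M : Matrix (Fin m) (Fin m) ℝ) (hM : IsUnit M.det) :
    LinearMap.det (matrixEquiv M hM : Rn m →ₗ[ℝ] Rn m) = M.det := by
  have : (matrixEquiv M hM : Rn m →ₗ[ℝ] Rn m) = Matrix.toLpLin 2 2 M := by
    ext x; rfl
  rw [this, Matrix.toLpLin_eq_toLin, LinearMap.det_toLin]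

lemma inner_matrixEquiv (M : Matrix (Fin m) (Fin m) ℝ) (hM : IsUnit M.det)
    (hM' : IsUnit Mᵀ.det) (x w : Rn m) :
    inner ℝ (matrixEquiv M hM x) w = inner ℝ x (matrixEquiv Mᵀ hM' w) := by
  rw [matrixEquiv_apply, matrixEquiv_apply, EuclideanSpace.inner_eq_star_dotProduct,
    EuclideanSpace.inner_eq_star_dotProduct]
  simp only [star_trivial]
  rw [Matrix.dotProduct_mulVec, Matrix.mulVec_transpose]

lemma lintegral_comp_matrix_inv (M : Matrix (Fin m) (Fin m) ℝ) (hM : IsUnit M.det)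
    (G : Rn m → ℝ≥0∞) : ∫⁻ x : Rn m, G (WithLp.toLp 2 (M⁻¹ *ᵥ x.ofLp)) =
      ENNReal.ofReal |M.det| * ∫⁻ x, G x := by
  have h := Measure.map_linearMap_addHaar_eq_smul_addHaar
    (f := ((matrixEquiv M hM).symm : Rn m →ₗ[ℝ] Rn m)) volume
    (LinearEquiv.isUnit_det' (matrixEquiv M hM).symm.toLinearEquiv).ne_zero
  have hd : (LinearMap.det ((matrixEquiv M hM).symm : Rn m →ₗ[ℝ] Rn m))⁻¹ = M.det := by
    rw [← det_matrixEquiv M hM]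
    exact inv_eq_of_mul_eq_one_left
      (LinearEquiv.det_mul_det_symm (matrixEquiv M hM).toLinearEquiv)
  rw [hd] at h
  have he : MeasurableEmbedding (matrixEquiv M hM).symm :=
    (matrixEquiv M hM).symm.toHomeomorph.measurableEmbedding
  calc _ = ∫⁻ x, G x ∂((volume : Measure (Rn m)).map (matrixEquiv M hM).symm) :=
        (he.lintegral_map G).symm
    _ = _ := by
      erw [h]
      exact lintegral_smul_measure _ _

lemma quasiMeasurePreserving_matrix_inv (M : Matrix (Fin m) (Fin m) ℝ) (hM : IsUnit M.det) :
    Measure.QuasiMeasurePreserving (fun x : Rn m => WithLp.toLp 2 (M⁻¹ *ᵥ x.ofLp))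
      volume volume := by
  have hc : Measurable fun x : Rn m => WithLp.toLp 2 (M⁻¹ *ᵥ x.ofLp) :=
    (matrixEquiv M hM).symm.continuous.measurable
  refine ⟨hc, Measure.AbsolutelyContinuous.mk fun s hs h => ?_⟩
  rw [Measure.map_apply hc hs]
  have := lintegral_comp_matrix_inv M hM (s.indicator 1)
  rw [lintegral_indicator_one hs, h, mul_zero] at this
  rw [← lintegral_indicator_one (hc hs)]
  exact this

lemma fourierL2_comp_matrix_inv (M : Matrix (Fin m) (Fin m) ℝ) (hM : IsUnit M.det) {f : Rn m → ℂ}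
    (hf : MemLp f 2 volume) :
    fourierL2 (fun x => f (WithLp.toLp 2 (M⁻¹ *ᵥ x.ofLp))) =ᵐ[volume] fun w =>
      ((|M.det| : ℝ) : ℂ) * fourierL2 f (WithLp.toLp 2 (Mᵀ *ᵥ w.ofLp)) := by
  have hM' : IsUnit Mᵀ.det := by rwa [Matrix.det_transpose]
  have := fourierL2_comp_symm (matrixEquiv M hM) (matrixEquiv Mᵀ hM')
    (inner_matrixEquiv M hM hM') hf
  rwa [det_matrixEquiv] at this

/-! ### Dilations and shears -/

/-- The diagonal entry `sg(a) |a|^{1/(2n)}` of the dilation matrix. -/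
def dilEntry (n : ℕ) (a : ℝ) : ℝ := Real.sign a * |a| ^ (1 / (2 * (n : ℝ)))

/-- The matrix `S_s A_a`, whose inverse defines the shearlet. -/
def shearDil (a : ℝ) (s : Rn (2 * n - 1)) : Matrix (Fin (2 * n)) (Fin (2 * n)) ℝ :=
  shearMatrix s * dilationMatrix n a

lemma shearlet_apply (ψ : Rn (2 * n) → ℍ[ℝ]) (a : ℝ) (s : Rn (2 * n - 1)) (t x : Rn (2 * n)) :
    shearlet ψ a s t x = |a| ^ (1 / (4 * (n : ℝ)) - 1) •
      ψ (WithLp.toLp 2 ((shearDil a s)⁻¹ *ᵥ (x - t).ofLp)) := by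
  rw [shearlet, shearDil, Matrix.mul_inv_rev]

lemma abs_sign_of_ne_zero {a : ℝ} (ha : a ≠ 0) : |Real.sign a| = 1 := by
  rcases Real.sign_apply_eq_of_ne_zero a ha with h | h <;> simp [h]

lemma abs_dilEntry {a : ℝ} (ha : a ≠ 0) : |dilEntry n a| = |a| ^ (1 / (2 * (n : ℝ))) := by
  rw [dilEntry, abs_mul, abs_sign_of_ne_zero ha, one_mul, abs_of_nonneg (by positivity)]

lemma dilEntry_ne_zero {a : ℝ} (ha : a ≠ 0) : dilEntry n a ≠ 0 := by
  rw [← abs_ne_zero, abs_dilEntry ha]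
  exact (Real.rpow_pos_of_pos (abs_pos.2 ha) _).ne'

lemma det_shearMatrix (s : Rn (2 * n - 1)) : (shearMatrix s).det = 1 := by
  rw [Matrix.det_of_isUpperTriangular]
  · simp [shearMatrix]
  · intro k l hkl
    have h1 : k ≠ l := fun h => by subst h; exact lt_irrefl _ hkl
    have h2 : k.val ≠ 0 := by
      have : l.val < k.val := hkl
      omega
    simp [shearMatrix, h1, h2]

lemma det_dilationMatrix [NeZero n] (a : ℝ) :
    (dilationMatrix n a).det = a * dilEntry n a ^ (2 * n - 1) := by
  obtain ⟨k, rfl⟩ := Nat.exists_eq_succ_of_ne_zero (NeZero.ne n)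
  rw [dilationMatrix, Matrix.det_diagonal]
  change ∏ i : Fin (2 * k + 1 + 1), _ = a * _ ^ (2 * k + 1)
  rw [Fin.prod_univ_succ]
  simp [dilEntry]

lemma det_shearDil [NeZero n] (a : ℝ) (s : Rn (2 * n - 1)) :
    (shearDil a s).det = a * dilEntry n a ^ (2 * n - 1) := by
  rw [shearDil, Matrix.det_mul, det_shearMatrix, one_mul, det_dilationMatrix]

lemma isUnit_det_shearDil [NeZero n] {a : ℝ} (ha : a ≠ 0) (s : Rn (2 * n - 1)) :
    IsUnit (shearDil a s).det := by
  rw [det_shearDil]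
  exact (mul_ne_zero ha (pow_ne_zero _ (dilEntry_ne_zero ha))).isUnit

lemma abs_det_shearDil [NeZero n] {a : ℝ} (ha : a ≠ 0) (s : Rn (2 * n - 1)) :
    |(shearDil a s).det| = |a| ^ (2 - 1 / (2 * (n : ℝ))) := by
  have hn : 0 < n := Nat.pos_of_ne_zero (NeZero.ne n)
  have hn' : (n : ℝ) ≠ 0 := Nat.cast_ne_zero.2 hn.ne'
  rw [det_shearDil, abs_mul, abs_pow, abs_dilEntry ha, ← Real.rpow_natCast, ← Real.rpow_mul
    (abs_nonneg a)]
  nth_rewrite 1 [← Real.rpow_one |a|]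
  rw [← Real.rpow_add (abs_pos.2 ha), Nat.cast_sub (by omega)]
  congr 1
  push_cast
  field_simp
  ring

/-- The normalization of the shearlets is unitary. -/
lemma sq_mul_abs_det_shearDil [NeZero n] {a : ℝ} (ha : a ≠ 0) (s : Rn (2 * n - 1)) :
    (|a| ^ (1 / (4 * (n : ℝ)) - 1)) ^ 2 * |(shearDil a s).det| = 1 := by
  have hn' : (n : ℝ) ≠ 0 := Nat.cast_ne_zero.2 (NeZero.ne n)
  rw [abs_det_shearDil ha, ← Real.rpow_natCast, ← Real.rpow_mul (abs_nonneg a),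
    ← Real.rpow_add (abs_pos.2 ha)]
  convert Real.rpow_zero _ using 2
  push_cast
  field_simp
  ring

/-- The point of `ℝ^{2n}` with first coordinate `b` and remaining coordinates `s`. -/
def consPt (b : ℝ) (s : Rn (2 * n - 1)) : Rn (2 * n) :=
  WithLp.toLp 2 fun k => if k.val = 0 then b else s ⟨k.val - 1, by omega⟩

/-- All coordinates of a point of `ℝ^{2n}` but the first. -/
def tailPt (w : Rn (2 * n)) : Rn (2 * n - 1) :=
  WithLp.toLp 2 fun k => w ⟨k.val + 1, by omega⟩

lemma shearDil_transpose_mulVec [NeZero n] (a : ℝ) (s : Rn (2 * n - 1)) (w : Rn (2 * n)) :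
    WithLp.toLp 2 ((shearDil a s)ᵀ *ᵥ w.ofLp) =
      consPt (a * w 0) ((dilEntry n a * w 0) • s + dilEntry n a • tailPt w) := by
  ext k
  have h1 : ((shearDil a s)ᵀ *ᵥ w.ofLp) k =
      (if k.val = 0 then a else dilEntry n a) * ∑ l, shearMatrix s l k * w l := by
    simp only [shearDil, dilationMatrix, Matrix.mulVec, dotProduct, Matrix.transpose_apply,
      Matrix.mul_diagonal, Finset.mul_sum, dilEntry]
    refine Finset.sum_congr rfl fun l _ => ?_
    ring
  have h0 : ((0 : Fin (2 * n)) : ℕ) = 0 := by simp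
  change ((shearDil a s)ᵀ *ᵥ w.ofLp) k = if k.val = 0 then a * w 0 else _
  rw [h1]
  by_cases hk : k.val = 0
  · have hk0 : k = 0 := Fin.ext (hk.trans h0.symm)
    subst hk0
    rw [if_pos h0, if_pos h0, Finset.sum_eq_single 0]
    · simp [shearMatrix]
    · intro l _ hl
      simp [shearMatrix, hl]
    · simp
  · have hk0 : k ≠ 0 := fun h => hk (by rw [h, h0])
    rw [if_neg hk, if_neg hk, Finset.sum_eq_add_of_mem 0 k (Finset.mem_univ _) (Finset.mem_univ _)
      hk0.symm]
    · have e : (⟨k.val - 1 + 1, by omega⟩ : Fin (2 * n)) = k := Fin.ext (by simp; omega)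
      simp only [shearMatrix, Matrix.of_apply, if_neg hk0.symm, h0, if_true, tailPt,
        PiLp.add_apply, PiLp.smul_apply, smul_eq_mul, e]
      ring
    · intro l _ hl
      simp [shearMatrix, hl.1, hl.2]

/-! ### The Calderón integral over dilations and shears -/

lemma lintegral_comp_smul_add {V : Type*} [NormedAddCommGroup V] [NormedSpace ℝ V]
    [MeasurableSpace V] [BorelSpace V] [FiniteDimensional ℝ V] (μ : Measure V)
    [μ.IsAddHaarMeasure] {c : ℝ} (hc : c ≠ 0) (v : V) {G : V → ℝ≥0∞} (hG : Measurable G) :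
    ENNReal.ofReal (|c| ^ Module.finrank ℝ V) * ∫⁻ s, G (c • s + v) ∂μ = ∫⁻ s, G s ∂μ := by
  have hGv : Measurable fun s => G (s + v) := hG.comp (measurable_add_const v)
  have h1 : ∫⁻ s, G (c • s + v) ∂μ =
      ENNReal.ofReal |(c ^ Module.finrank ℝ V)⁻¹| * ∫⁻ s, G (s + v) ∂μ := by
    rw [← smul_eq_mul, ← lintegral_smul_measure, ← Measure.map_addHaar_smul μ hc,
      lintegral_map hGv (measurable_const_smul c)]
  rw [h1, lintegral_add_right_eq_self, ← mul_assoc, ← ENNReal.ofReal_mul (by positivity), abs_inv,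
    abs_pow, mul_inv_cancel₀ (pow_ne_zero _ (abs_ne_zero.2 hc)), ENNReal.ofReal_one, one_mul]

lemma measurable_consPt : Measurable fun z : ℝ × Rn (2 * n - 1) => consPt z.1 z.2 := by
  refine (PiLp.continuous_toLp 2 _).measurable.comp (measurable_pi_lambda _ fun k => ?_)
  by_cases hk : k.val = 0
  · simp only [hk, if_true]; exact measurable_fst
  · simp only [hk, if_false]; fun_prop

lemma consPt_zero [NeZero n] (b : ℝ) (s : Rn (2 * n - 1)) : consPt b s 0 = b := by
  simp [consPt]

/-- Fubini's theorem for the splitting of `ℝ^{2n}` into its first and its other coordinates. -/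
lemma lintegral_consPt [NeZero n] {G : Rn (2 * n) → ℝ≥0∞} (hG : Measurable G) :
    ∫⁻ b, ∫⁻ s, G (consPt b s) = ∫⁻ w, G w := by
  obtain ⟨k, rfl⟩ := Nat.exists_eq_succ_of_ne_zero (NeZero.ne n)
  have h1 := (PiLp.volume_preserving_toLp (Fin (2 * k + 1 + 1))).lintegral_comp hG
  have h2 := (volume_preserving_piFinSuccAbove (fun _ : Fin (2 * k + 1 + 1) => ℝ) 0).symm
  have hG' : Measurable fun x : Fin (2 * k + 1 + 1) → ℝ => G (WithLp.toLp 2 x) :=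
    hG.comp (PiLp.continuous_toLp 2 _).measurable
  have hG2 : Measurable fun z : ℝ × (Fin (2 * k + 1) → ℝ) =>
      G (WithLp.toLp 2 ((MeasurableEquiv.piFinSuccAbove (fun _ => ℝ) 0).symm z)) :=
    hG'.comp h2.measurable
  refine Eq.trans ?_ ((lintegral_prod _ hG2.aemeasurable).symm.trans
    ((h2.lintegral_comp hG').trans h1))
  refine lintegral_congr fun b => ?_
  have h3 := (PiLp.volume_preserving_ofLp (Fin (2 * k + 1))).lintegral_comp
    (hG'.comp (h2.measurable.comp (measurable_prodMk_left (x := b))))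
  refine Eq.trans ?_ h3
  refine lintegral_congr fun s => ?_
  simp only [Function.comp_apply]
  refine congrArg G (PiLp.ext fun j => ?_)
  change (if j.val = 0 then b else s ⟨j.val - 1, _⟩) =
    Fin.insertNth (α := fun _ : Fin (2 * k + 1 + 1) => ℝ) 0 b s.ofLp j
  refine Fin.cases ?_ (fun i => ?_) j
  · simp
  · simp

/-- The Calderón integral does not depend on the frequency: for `w` with nonzero first coordinate,
`(a, s) ↦ A_a S_s^T w` transports the shearlet measure to `|λ_1|^{-2n} dλ`. -/
lemma lintegral_dilation_shear [NeZero n] {H : Rn (2 * n) → ℝ≥0∞} (hH : Measurable H)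
    {w : Rn (2 * n)} (hw : w 0 ≠ 0) :
    ∫⁻ a : ℝ, ∫⁻ s : Rn (2 * n - 1), ENNReal.ofReal (1 / |a| ^ (2 * n + 1)) *
      (ENNReal.ofReal |(shearDil a s).det| * H (WithLp.toLp 2 ((shearDil a s)ᵀ *ᵥ w.ofLp))) =
    ∫⁻ w, H w * ENNReal.ofReal (1 / |w 0| ^ (2 * n)) := by
  have hHc : ∀ b, Measurable fun s : Rn (2 * n - 1) => H (consPt b s) := fun b =>
    hH.comp (measurable_consPt.comp measurable_prodMk_left)
  set J : ℝ → ℝ≥0∞ := fun b => ∫⁻ s, H (consPt b s) * ENNReal.ofReal (1 / |b| ^ (2 * n)) with hJ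
  have hJm : Measurable J :=
    Measurable.lintegral_prod_right' (f := fun z : ℝ × Rn (2 * n - 1) =>
      H (consPt z.1 z.2) * ENNReal.ofReal (1 / |z.1| ^ (2 * n)))
      ((hH.comp measurable_consPt).mul (by fun_prop))
  -- substitution in the shear variable: the powers of `|a|` and of `|w 0|` combine to those of `J`
  have hinner : ∀ a : ℝ, a ≠ 0 → ∫⁻ s : Rn (2 * n - 1), ENNReal.ofReal (1 / |a| ^ (2 * n + 1)) *
      (ENNReal.ofReal |(shearDil a s).det| * H (WithLp.toLp 2 ((shearDil a s)ᵀ *ᵥ w.ofLp))) =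
      ENNReal.ofReal |w 0| * J (w 0 * a) := by
    intro a ha
    have hc : dilEntry n a * w 0 ≠ 0 := mul_ne_zero (dilEntry_ne_zero ha) hw
    have hs := lintegral_comp_smul_add volume hc (dilEntry n a • tailPt w) (hHc (a * w 0))
    simp only [shearDil_transpose_mulVec, det_shearDil]
    rw [hJ]
    beta_reduce
    rw [lintegral_const_mul' _ _ ENNReal.ofReal_ne_top,
      lintegral_const_mul' _ _ ENNReal.ofReal_ne_top,
      lintegral_mul_const' _ _ ENNReal.ofReal_ne_top, mul_comm (w 0) a, ← hs,
      finrank_euclideanSpace, Fintype.card_fin, mul_comm (_ * _) (ENNReal.ofReal (1 / _)),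
      ← mul_assoc, ← mul_assoc, ← mul_assoc, ← ENNReal.ofReal_mul (by positivity),
      ← ENNReal.ofReal_mul (by positivity), ← ENNReal.ofReal_mul (by positivity)]
    congr 2
    have hn : 0 < n := Nat.pos_of_ne_zero (NeZero.ne n)
    have ha' : |a| ≠ 0 := abs_ne_zero.2 ha
    have hw' : |w 0| ≠ 0 := abs_ne_zero.2 hw
    rw [abs_mul, abs_mul, abs_mul, abs_pow, mul_pow, mul_pow]
    have e : |w 0| ^ (2 * n) = |w 0| * |w 0| ^ (2 * n - 1) := by
      rw [← pow_succ']; congr 1; omega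
    rw [e, pow_succ]
    field_simp
  have hae : ∀ᵐ a : ℝ, a ≠ 0 := by
    rw [ae_iff]; simp
  calc _ = ∫⁻ a, ENNReal.ofReal |w 0| * J (w 0 * a) := by
        refine lintegral_congr_ae ?_
        filter_upwards [hae] with a ha using hinner a ha
    _ = ∫⁻ b, J b := by
        rw [lintegral_const_mul' _ _ ENNReal.ofReal_ne_top]
        simpa using lintegral_comp_smul_add volume hw 0 hJm
    _ = _ := by
        have hHw : Measurable fun w : Rn (2 * n) => H w * ENNReal.ofReal (1 / |w 0| ^ (2 * n)) :=
          hH.mul (by fun_prop)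
        rw [← lintegral_consPt hHw]
        refine lintegral_congr fun b => ?_
        simp only [hJ, consPt_zero]

/-! ### Size and measurability of the shearlet transform -/

lemma lintegral_enorm_mul_le {α E F : Type*} [MeasurableSpace α] [NormedAddCommGroup E]
    [NormedAddCommGroup F] {μ : Measure α} {f : α → E} {g : α → F}
    (hf : AEStronglyMeasurable f μ) (hg : AEStronglyMeasurable g μ) :
    ∫⁻ x, ‖f x‖ₑ * ‖g x‖ₑ ∂μ ≤ eLpNorm f 2 μ * eLpNorm g 2 μ := by
  rw [eLpNorm_eq_lintegral_rpow_enorm_toReal (by norm_num) (by norm_num),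
    eLpNorm_eq_lintegral_rpow_enorm_toReal (by norm_num) (by norm_num)]
  exact ENNReal.lintegral_mul_le_Lp_mul_Lq μ (by simpa using Real.HolderConjugate.two_two)
    hf.enorm hg.enorm

section Shearlet

variable [NeZero n] {a : ℝ} (s : Rn (2 * n - 1)) (t : Rn (2 * n))

lemma quasiMeasurePreserving_shearDil (ha : a ≠ 0) : Measure.QuasiMeasurePreserving
    (fun x : Rn (2 * n) => WithLp.toLp 2 ((shearDil a s)⁻¹ *ᵥ (x - t).ofLp)) volume volume :=
  (quasiMeasurePreserving_matrix_inv _ (isUnit_det_shearDil ha s)).comp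
    (measurePreserving_sub_right volume t).quasiMeasurePreserving

lemma shearlet_congr (ha : a ≠ 0) {ψ ψ' : Rn (2 * n) → ℍ[ℝ]} (h : ψ =ᵐ[volume] ψ') :
    shearlet ψ a s t =ᵐ[volume] shearlet ψ' a s t := by
  filter_upwards [(quasiMeasurePreserving_shearDil s t ha).ae h] with x hx
  rw [shearlet_apply, shearlet_apply, hx]

lemma aestronglyMeasurable_shearlet (ha : a ≠ 0) {ψ : Rn (2 * n) → ℍ[ℝ]}
    (hψ : AEStronglyMeasurable ψ volume) :
    AEStronglyMeasurable (shearlet ψ a s t) volume := by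
  have h : shearlet ψ a s t = fun x => |a| ^ (1 / (4 * (n : ℝ)) - 1) •
      ψ (WithLp.toLp 2 ((shearDil a s)⁻¹ *ᵥ (x - t).ofLp)) :=
    funext fun x => shearlet_apply ψ a s t x
  rw [h]
  exact (hψ.comp_quasiMeasurePreserving (quasiMeasurePreserving_shearDil s t ha)).const_smul
    (|a| ^ (1 / (4 * (n : ℝ)) - 1))

lemma eLpNorm_shearlet (ha : a ≠ 0) (ψ : Rn (2 * n) → ℍ[ℝ]) :
    eLpNorm (shearlet ψ a s t) 2 volume = eLpNorm ψ 2 volume := by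
  refine (ENNReal.pow_right_strictMono (n := 2) (by norm_num)).injective ?_
  beta_reduce
  rw [eLpNorm_two_sq, eLpNorm_two_sq]
  simp only [shearlet_apply, enorm_smul, mul_pow]
  rw [lintegral_const_mul' _ _ (by simp), lintegral_sub_right_eq_self
    (fun x : Rn (2 * n) => ‖ψ (WithLp.toLp 2 ((shearDil a s)⁻¹ *ᵥ x.ofLp))‖ₑ ^ 2) t,
    lintegral_comp_matrix_inv _ (isUnit_det_shearDil ha s) (fun x => ‖ψ x‖ₑ ^ 2), ← mul_assoc,
    Real.enorm_of_nonneg (by positivity), ← ENNReal.ofReal_pow (by positivity),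
    ← ENNReal.ofReal_mul (by positivity), sq_mul_abs_det_shearDil ha, ENNReal.ofReal_one, one_mul]

end Shearlet

/-- The pointwise bound `|SH_ψ f| ≤ ‖f‖₂ ‖ψ‖₂`. -/
lemma enorm_shearletTransform_le [NeZero n] {ψ f : Rn (2 * n) → ℍ[ℝ]}
    (hψ : AEStronglyMeasurable ψ volume) (hf : AEStronglyMeasurable f volume)
    {z : ℝ × Rn (2 * n - 1) × Rn (2 * n)} (hz : z.1 ≠ 0) :
    ‖shearletTransform ψ f z‖ₑ ≤ eLpNorm f 2 volume * eLpNorm ψ 2 volume := by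
  rw [← eLpNorm_shearlet z.2.1 z.2.2 hz ψ]
  refine (enorm_integral_le_lintegral_enorm _).trans ?_
  simp only [enorm_mul, enorm_star_eq]
  exact lintegral_enorm_mul_le hf (aestronglyMeasurable_shearlet _ _ hz hψ)

lemma shearletTransform_congr [NeZero n] {ψ ψ' f f' : Rn (2 * n) → ℍ[ℝ]} (hψ : ψ =ᵐ[volume] ψ')
    (hf : f =ᵐ[volume] f') {z : ℝ × Rn (2 * n - 1) × Rn (2 * n)} (hz : z.1 ≠ 0) :
    shearletTransform ψ f z = shearletTransform ψ' f' z := by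
  refine integral_congr_ae ?_
  filter_upwards [hf, shearlet_congr z.2.1 z.2.2 hz hψ] with x h1 h2
  rw [h1, h2]

lemma measurable_dilEntry : Measurable (dilEntry n) := by
  have h : Measurable Real.sign := by
    unfold Real.sign
    exact Measurable.ite measurableSet_Iio measurable_const
      (Measurable.ite measurableSet_Ioi measurable_const measurable_const)
  exact h.mul (by fun_prop)

lemma measurable_shearDil : Measurable fun (z : ℝ × Rn (2 * n - 1)) (k l : Fin (2 * n)) =>
    shearDil z.1 z.2 k l := by
  refine measurable_pi_lambda _ fun k => measurable_pi_lambda _ fun l => ?_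
  have h : ∀ z : ℝ × Rn (2 * n - 1), shearDil z.1 z.2 k l =
      shearMatrix z.2 k l * if l.val = 0 then z.1 else dilEntry n z.1 := fun z => by
    rw [shearDil, dilationMatrix, Matrix.mul_diagonal]; rfl
  simp only [h]
  refine Measurable.mul ?_ ?_
  · simp only [shearMatrix, Matrix.of_apply]
    split_ifs <;> fun_prop
  · split_ifs
    · exact measurable_fst
    · exact measurable_dilEntry.comp measurable_fst

lemma measurable_shearDil_inv (k l : Fin (2 * n)) :
    Measurable fun z : ℝ × Rn (2 * n - 1) => (shearDil z.1 z.2)⁻¹ k l := by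
  have h : ∀ z : ℝ × Rn (2 * n - 1), (shearDil z.1 z.2)⁻¹ k l =
      (shearDil z.1 z.2).det⁻¹ * (shearDil z.1 z.2).adjugate k l := fun z => by
    rw [Matrix.inv_def, Ring.inverse_eq_inv', Matrix.smul_apply, smul_eq_mul]
  simp only [h]
  have h1 : Continuous fun M : Fin (2 * n) → Fin (2 * n) → ℝ => Matrix.det (Matrix.of M) :=
    Continuous.matrix_det continuous_id
  have h2 : Continuous fun M : Fin (2 * n) → Fin (2 * n) → ℝ =>
      Matrix.adjugate (Matrix.of M) k l :=
    (Continuous.matrix_adjugate (continuous_id : Continuous fun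
      M : Matrix (Fin (2 * n)) (Fin (2 * n)) ℝ => M)).matrix_elem k l
  exact (h1.measurable.comp measurable_shearDil).inv.mul (h2.measurable.comp measurable_shearDil)

lemma measurable_shearDil_inv_mulVec :
    Measurable fun q : (ℝ × Rn (2 * n - 1) × Rn (2 * n)) × Rn (2 * n) =>
      (WithLp.toLp 2 ((shearDil q.1.1 q.1.2.1)⁻¹ *ᵥ (q.2 - q.1.2.2).ofLp) : Rn (2 * n)) := by
  refine (PiLp.continuous_toLp 2 _).measurable.comp (measurable_pi_lambda _ fun k => ?_)
  simp only [Matrix.mulVec, dotProduct]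
  refine Finset.measurable_sum _ fun l _ => Measurable.mul ?_ ?_
  · have hp : Measurable fun q : (ℝ × Rn (2 * n - 1) × Rn (2 * n)) × Rn (2 * n) =>
        (q.1.1, q.1.2.1) := by fun_prop
    have h := (measurable_shearDil_inv k l).comp hp
    simp only [Function.comp_def] at h
    exact h
  · fun_prop

lemma stronglyMeasurable_shearletTransform {ψ f : Rn (2 * n) → ℍ[ℝ]} (hψ : StronglyMeasurable ψ)
    (hf : StronglyMeasurable f) : StronglyMeasurable (shearletTransform ψ f) := by
  have hc : Measurable fun q : (ℝ × Rn (2 * n - 1) × Rn (2 * n)) × Rn (2 * n) =>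
      |q.1.1| ^ (1 / (4 * (n : ℝ)) - 1) := by fun_prop
  have h1 : StronglyMeasurable fun q : (ℝ × Rn (2 * n - 1) × Rn (2 * n)) × Rn (2 * n) =>
      shearlet ψ q.1.1 q.1.2.1 q.1.2.2 q.2 := by
    simp only [shearlet_apply]
    exact hc.stronglyMeasurable.smul (hψ.comp_measurable measurable_shearDil_inv_mulVec)
  have h2 : StronglyMeasurable fun q : (ℝ × Rn (2 * n - 1) × Rn (2 * n)) × Rn (2 * n) =>
      f q.2 * star (shearlet ψ q.1.1 q.1.2.1 q.1.2.2 q.2) :=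
    (hf.comp_measurable measurable_snd).mul (continuous_star.comp_stronglyMeasurable h1)
  exact h2.integral_prod_right'

/-! ### The energy bound -/

/-- For a fixed dilation and shear, the energy of the transform in the translation variable. The
quaternionic function `f` enters through its two complex coordinates over `span {1, j}`. -/
lemma lintegral_translation_le [NeZero n] {η : Rn (2 * n) → ℂ} {f : Rn (2 * n) → ℍ[ℝ]}
    (hη : MemLp η 2 volume) (hf : MemLp f 2 volume) {a : ℝ} (ha : a ≠ 0) (s : Rn (2 * n - 1)) :
    ∫⁻ t, ‖shearletTransform (fun x => ofC (η x)) f (a, s, t)‖ₑ ^ 2 ≤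
      ∫⁻ w : Rn (2 * n), (‖fourierL2 (fun x => toC (f x)) w‖ₑ ^ 2 +
        ‖fourierL2 (fun x => toC' (f x)) w‖ₑ ^ 2) * (ENNReal.ofReal |(shearDil a s).det| *
          ‖fourierL2 η (WithLp.toLp 2 ((shearDil a s)ᵀ *ᵥ w.ofLp))‖ₑ ^ 2) := by
  set M := shearDil a s with hM
  have hMu : IsUnit M.det := isUnit_det_shearDil ha s
  set c : ℝ := |a| ^ (1 / (4 * (n : ℝ)) - 1) with hc
  set k : Rn (2 * n) → ℂ := fun x => η (WithLp.toLp 2 (M⁻¹ *ᵥ x.ofLp)) with hk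
  have hk2 : MemLp k 2 volume := by
    refine ⟨hη.1.comp_quasiMeasurePreserving (quasiMeasurePreserving_matrix_inv M hMu), ?_⟩
    have h := lintegral_comp_matrix_inv M hMu (fun x => ‖η x‖ₑ ^ 2)
    have h' : eLpNorm k 2 volume ^ 2 < ∞ := by
      rw [eLpNorm_two_sq]
      refine h.trans_lt ?_
      rw [← eLpNorm_two_sq]
      exact ENNReal.mul_lt_top ENNReal.ofReal_lt_top (ENNReal.pow_lt_top hη.2)
    by_contra hne
    rw [not_lt_top_iff.1 hne] at h'
    simp at h'
  set h : Rn (2 * n) → ℂ := fun x => (c : ℂ) * k x with hh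
  have hh2 : MemLp h 2 volume := hk2.const_mul _
  have hf1 : MemLp (fun x => toC (f x)) 2 volume := toC.comp_memLp' hf
  have hf2 : MemLp (fun x => toC' (f x)) 2 volume := toC'.comp_memLp' hf
  have hhat : ∀ᵐ w, ‖fourierL2 h w‖ₑ ^ 2 = ENNReal.ofReal |M.det| *
      ‖fourierL2 η (WithLp.toLp 2 (Mᵀ *ᵥ w.ofLp))‖ₑ ^ 2 := by
    filter_upwards [fourierL2_smul (c : ℂ) hk2, fourierL2_comp_matrix_inv M hMu hη] with w h1 h2
    rw [h1, h2, enorm_mul, enorm_mul, mul_pow, mul_pow, ← mul_assoc]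
    congr 1
    have e : ∀ r : ℝ, 0 ≤ r → ‖(r : ℂ)‖ₑ = ENNReal.ofReal r := fun r hr => by
      rw [← ofReal_norm, Complex.norm_of_nonneg hr]
    rw [e _ (by positivity), e _ (abs_nonneg _), ← ENNReal.ofReal_pow (by positivity),
      ← ENNReal.ofReal_pow (abs_nonneg _), ← ENNReal.ofReal_mul (by positivity), pow_two |M.det|,
      ← mul_assoc, sq_mul_abs_det_shearDil ha, one_mul]
  have hSH : ∀ t, ‖shearletTransform (fun x => ofC (η x)) f (a, s, t)‖ₑ ^ 2 =
      ‖∫ x, toC (f x) * star (h (x - t))‖ₑ ^ 2 + ‖∫ x, toC' (f x) * star (h (x - t))‖ₑ ^ 2 := by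
    intro t
    have hht := (l2Bounded_translate t).memLp h hh2
    have i1 := integrable_mul_star hf1 hht
    have i2 := integrable_mul_star hf2 hht
    rw [← enorm_sq_ofC_add, ← ofC.integral_comp_comm i1, ← ofC'.integral_comp_comm i2,
      ← integral_add (ofC.integrable_comp i1) (ofC'.integrable_comp i2), shearletTransform]
    congr 2
    refine integral_congr_ae (Filter.Eventually.of_forall fun x => ?_)
    beta_reduce
    rw [shearlet_apply, ← map_smul, mul_star_ofC]
    rfl
  have hm1 : Measurable fun t => ‖∫ x, toC (f x) * star (h (x - t))‖ₑ ^ 2 :=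
    (continuous_correlation hf1 hh2).measurable.enorm.pow_const 2
  have hm2 : Measurable fun w => ‖fourierL2 (fun x => toC (f x)) w‖ₑ ^ 2 * ‖fourierL2 h w‖ₑ ^ 2 :=
    ((stronglyMeasurable_fourierL2 _).enorm.pow_const 2).mul
      ((stronglyMeasurable_fourierL2 _).enorm.pow_const 2)
  calc _ = ∫⁻ t, (‖∫ x, toC (f x) * star (h (x - t))‖ₑ ^ 2 +
        ‖∫ x, toC' (f x) * star (h (x - t))‖ₑ ^ 2) := lintegral_congr hSH
    _ = (∫⁻ t, ‖∫ x, toC (f x) * star (h (x - t))‖ₑ ^ 2) +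
        ∫⁻ t, ‖∫ x, toC' (f x) * star (h (x - t))‖ₑ ^ 2 := lintegral_add_left hm1 _
    _ ≤ (∫⁻ w, ‖fourierL2 (fun x => toC (f x)) w‖ₑ ^ 2 * ‖fourierL2 h w‖ₑ ^ 2) +
        ∫⁻ w, ‖fourierL2 (fun x => toC' (f x)) w‖ₑ ^ 2 * ‖fourierL2 h w‖ₑ ^ 2 :=
      add_le_add (lintegral_correlation_sq_le hf1 hh2) (lintegral_correlation_sq_le hf2 hh2)
    _ = _ := by
      rw [← lintegral_add_left hm2]
      refine lintegral_congr_ae ?_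
      filter_upwards [hhat] with w hw
      rw [hw, add_mul]

lemma measurable_calderon_integrand [NeZero n] {H : Rn (2 * n) → ℝ≥0∞} (hH : Measurable H) :
    Measurable fun q : (ℝ × Rn (2 * n - 1)) × Rn (2 * n) =>
      ENNReal.ofReal (1 / |q.1.1| ^ (2 * n + 1)) * (ENNReal.ofReal |(shearDil q.1.1 q.1.2).det| *
        H (WithLp.toLp 2 ((shearDil q.1.1 q.1.2)ᵀ *ᵥ q.2.ofLp))) := by
  simp only [shearDil_transpose_mulVec, det_shearDil]
  have hd : Measurable fun q : (ℝ × Rn (2 * n - 1)) × Rn (2 * n) => dilEntry n q.1.1 :=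
    measurable_dilEntry.comp measurable_fst.fst
  have ht : Measurable (tailPt : Rn (2 * n) → Rn (2 * n - 1)) :=
    (PiLp.continuous_toLp 2 _).measurable.comp (measurable_pi_lambda _ fun k => by fun_prop)
  have h0 : Measurable fun q : (ℝ × Rn (2 * n - 1)) × Rn (2 * n) => q.2 0 := by fun_prop
  refine Measurable.mul (by fun_prop) (Measurable.mul ?_ (hH.comp ?_))
  · exact ((measurable_fst.fst.mul (hd.pow_const _)).abs).ennreal_ofReal
  · exact measurable_consPt.comp ((measurable_fst.fst.mul h0).prodMk
      (((hd.mul h0).smul measurable_fst.snd).add (hd.smul (ht.comp measurable_snd))))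

/-- The energy bound `‖SH_ψ f‖²_{2,μ} ≤ C_ψ ‖f‖₂²` for a shearlet with values in `span {1, j}`. -/
lemma lintegral_shearletTransform_sq_le [NeZero n] {η : Rn (2 * n) → ℂ} {f : Rn (2 * n) → ℍ[ℝ]}
    (hη : MemLp η 2 volume) (hf : MemLp f 2 volume) (hηm : StronglyMeasurable η)
    (hfm : StronglyMeasurable f) :
    ∫⁻ z, ‖shearletTransform (fun x => ofC (η x)) f z‖ₑ ^ 2 ∂(haarMeasure n) ≤
      (∫⁻ w : Rn (2 * n), ‖fourierL2 η w‖ₑ ^ 2 * ENNReal.ofReal (1 / |w 0| ^ (2 * n))) *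
        eLpNorm f 2 volume ^ 2 := by
  set S := shearletTransform (fun x => ofC (η x)) f with hS
  have hSm : Measurable fun z => ‖S z‖ₑ ^ 2 :=
    (stronglyMeasurable_shearletTransform (ofC.continuous.comp_stronglyMeasurable hηm)
      hfm).enorm.pow_const 2
  set H : Rn (2 * n) → ℝ≥0∞ := fun w => ‖fourierL2 η w‖ₑ ^ 2 with hH
  have hHm : Measurable H := (stronglyMeasurable_fourierL2 η).enorm.pow_const 2
  set F : Rn (2 * n) → ℝ≥0∞ := fun w => ‖fourierL2 (fun x => toC (f x)) w‖ₑ ^ 2 +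
    ‖fourierL2 (fun x => toC' (f x)) w‖ₑ ^ 2 with hF
  have hF1 : Measurable fun w => ‖fourierL2 (fun x => toC (f x)) w‖ₑ ^ 2 :=
    (stronglyMeasurable_fourierL2 _).enorm.pow_const 2
  have hFm : Measurable F := hF1.add ((stronglyMeasurable_fourierL2 _).enorm.pow_const 2)
  set K : (ℝ × Rn (2 * n - 1)) × Rn (2 * n) → ℝ≥0∞ := fun q =>
    ENNReal.ofReal (1 / |q.1.1| ^ (2 * n + 1)) * (ENNReal.ofReal |(shearDil q.1.1 q.1.2).det| *
      H (WithLp.toLp 2 ((shearDil q.1.1 q.1.2)ᵀ *ᵥ q.2.ofLp))) with hK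
  have hKm : Measurable K := measurable_calderon_integrand hHm
  have hFK : Measurable fun q : (ℝ × Rn (2 * n - 1)) × Rn (2 * n) => F q.2 * K q :=
    (hFm.comp measurable_snd).mul hKm
  have hae : ∀ᵐ a : ℝ, a ≠ 0 := by
    rw [ae_iff]; simp
  have hwt : Measurable fun z : ℝ × Rn (2 * n - 1) × Rn (2 * n) =>
      ENNReal.ofReal (1 / |z.1| ^ (2 * n + 1)) := by fun_prop
  have hFf : ∫⁻ w, F w = eLpNorm f 2 volume ^ 2 := by
    rw [hF, lintegral_add_left hF1,
      lintegral_fourierL2_sq (f := fun x => toC (f x)) (toC.comp_memLp' hf),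
      lintegral_fourierL2_sq (f := fun x => toC' (f x)) (toC'.comp_memLp' hf), ← lintegral_add_left,
      eLpNorm_two_sq]
    · refine lintegral_congr fun x => ?_
      rw [← enorm_sq_ofC_add, ofC_toC_add]
    · exact (toC.continuous.comp_stronglyMeasurable hfm).enorm.pow_const 2
  calc ∫⁻ z, ‖S z‖ₑ ^ 2 ∂(haarMeasure n)
      = ∫⁻ z in {z | z.1 ≠ 0}, ENNReal.ofReal (1 / |z.1| ^ (2 * n + 1)) * ‖S z‖ₑ ^ 2 := by
        rw [haarMeasure, lintegral_withDensity_eq_lintegral_mul _ hwt hSm]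
        rfl
    _ ≤ ∫⁻ z, ENNReal.ofReal (1 / |z.1| ^ (2 * n + 1)) * ‖S z‖ₑ ^ 2 :=
        setLIntegral_le_lintegral _ _
    _ ≤ ∫⁻ a, ∫⁻ y : Rn (2 * n - 1) × Rn (2 * n),
          ENNReal.ofReal (1 / |a| ^ (2 * n + 1)) * ‖S (a, y)‖ₑ ^ 2 :=
        lintegral_prod_le _
    _ ≤ ∫⁻ a, ∫⁻ s, ∫⁻ w, F w * K ((a, s), w) := by
        refine lintegral_mono_ae ?_
        filter_upwards [hae] with a ha
        refine (lintegral_prod_le _).trans (lintegral_mono fun s => ?_)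
        beta_reduce
        rw [lintegral_const_mul' _ _ ENNReal.ofReal_ne_top]
        refine (mul_le_mul_right (lintegral_translation_le hη hf ha s) _).trans_eq ?_
        rw [← lintegral_const_mul' _ _ ENNReal.ofReal_ne_top]
        refine lintegral_congr fun w => ?_
        rw [mul_left_comm]
    _ = ∫⁻ q : ℝ × Rn (2 * n - 1), ∫⁻ w, F w * K (q, w) :=
        (lintegral_prod _ hFK.lintegral_prod_right'.aemeasurable).symm
    _ = ∫⁻ w, ∫⁻ q : ℝ × Rn (2 * n - 1), F w * K (q, w) :=
        lintegral_lintegral_swap hFK.aemeasurable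
    _ = ∫⁻ w : Rn (2 * n), F w * ∫⁻ w : Rn (2 * n), H w * ENNReal.ofReal (1 / |w 0| ^ (2 * n)) := by
        refine lintegral_congr_ae ?_
        filter_upwards [ae_coord_ne_zero (0 : Fin (2 * n))] with w hw
        have hKw : Measurable fun q => K (q, w) := hKm.comp measurable_prodMk_right
        rw [lintegral_const_mul _ hKw, ← lintegral_dilation_shear hHm hw]
        congr 1
        exact lintegral_prod _ hKw.aemeasurable
    _ = _ := by rw [lintegral_mul_const _ hFm, hFf, mul_comm]

/-! ### The interpolated product estimate -/

lemma ae_haarMeasure_ne_zero : ∀ᵐ z ∂(haarMeasure n), z.1 ≠ 0 :=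
  (withDensity_absolutelyContinuous _ _).ae_le
    (ae_restrict_mem ((measurableSet_singleton (0 : ℝ)).compl.preimage measurable_fst))

/-- An admissible shearlet satisfying the convolution condition is, almost everywhere, a complex
function under the identification `ℂ ≃ span {1, j}`. -/
lemma ConvCondition.exists_ofC [NeZero n] {ψ : Rn (2 * n) → ℍ[ℝ]} (hc : ConvCondition ψ)
    (hψ : MemLp ψ 2 volume) : ∃ η : Rn (2 * n) → ℂ, MemLp η 2 volume ∧ StronglyMeasurable η ∧
      ψ =ᵐ[volume] fun x => ofC (η x) := by
  have h1 : MemLp (fun x => toC (ψ x)) 2 volume := toC.comp_memLp' hψ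
  refine ⟨h1.1.mk _, (memLp_congr_ae h1.1.ae_eq_mk).1 h1, h1.1.stronglyMeasurable_mk, ?_⟩
  filter_upwards [h1.1.ae_eq_mk, hc.splitQ_ae_eq hψ] with x h2 h3
  rw [← h2, ofC_toC_of_splitQ h3]

/-- The shearlet transform belongs to `L²(dμ)`, with norm at most `√C_ψ ‖f‖₂`. -/
lemma eLpNorm_shearletTransform_le [NeZero n] {ψ f : Rn (2 * n) → ℍ[ℝ]}
    (hψ : MemLp ψ 2 volume) (hc : ConvCondition ψ) (hf : MemLp f 2 volume) :
    AEStronglyMeasurable (shearletTransform ψ f) (haarMeasure n) ∧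
      eLpNorm (shearletTransform ψ f) 2 (haarMeasure n) ^ 2 ≤
        admConst ψ * eLpNorm f 2 volume ^ 2 := by
  obtain ⟨η, hη, hηm, h⟩ := hc.exists_ofC hψ
  obtain ⟨f₀, hfm, hf0⟩ := hf.1
  have e : shearletTransform ψ f =ᵐ[haarMeasure n]
      shearletTransform (fun x => ofC (η x)) f₀ := by
    filter_upwards [ae_haarMeasure_ne_zero] with z hz using shearletTransform_congr h hf0 hz
  refine ⟨⟨_, stronglyMeasurable_shearletTransform
    (ofC.continuous.comp_stronglyMeasurable hηm) hfm, e⟩, ?_⟩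
  rw [eLpNorm_congr_ae e, eLpNorm_two_sq, admConst_eq hη h, eLpNorm_congr_ae hf0]
  exact lintegral_shearletTransform_sq_le hη ((memLp_congr_ae hf0).1 hf) hηm hfm

/-- Interpolation between `L¹` and `L^∞`. -/
lemma eLpNorm_le_of_ae_le_of_lintegral_le {α E : Type*} [MeasurableSpace α]
    [NormedAddCommGroup E] {μ : Measure α} {F : α → E} {A B : ℝ≥0∞} {p : ℝ} (hp : 1 ≤ p)
    (hB : ∀ᵐ z ∂μ, ‖F z‖ₑ ≤ B) (hBt : B ≠ ∞) (hA : ∫⁻ z, ‖F z‖ₑ ∂μ ≤ A) :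
    eLpNorm F (ENNReal.ofReal p) μ ≤ A ^ (1 / p) * B ^ (1 - 1 / p) := by
  have hp0 : 0 < p := by linarith
  rw [eLpNorm_eq_lintegral_rpow_enorm_toReal (by simpa using hp0) (by simp),
    ENNReal.toReal_ofReal hp0.le]
  have h1 : ∫⁻ z, ‖F z‖ₑ ^ p ∂μ ≤ A * B ^ (p - 1) := by
    calc ∫⁻ z, ‖F z‖ₑ ^ p ∂μ ≤ ∫⁻ z, ‖F z‖ₑ * B ^ (p - 1) ∂μ := by
          refine lintegral_mono_ae ?_
          filter_upwards [hB] with z hz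
          calc ‖F z‖ₑ ^ p = ‖F z‖ₑ ^ (1 + (p - 1)) := by ring_nf
            _ = ‖F z‖ₑ * ‖F z‖ₑ ^ (p - 1) := by
              rw [ENNReal.rpow_add_of_nonneg _ _ zero_le_one (by linarith), ENNReal.rpow_one]
            _ ≤ _ := by gcongr
      _ = (∫⁻ z, ‖F z‖ₑ ∂μ) * B ^ (p - 1) :=
          lintegral_mul_const' _ _ (ENNReal.rpow_ne_top_of_nonneg (by linarith) hBt)
      _ ≤ _ := by gcongr
  calc _ ≤ (A * B ^ (p - 1)) ^ (1 / p) := by gcongr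
    _ = _ := by
      rw [ENNReal.mul_rpow_of_nonneg _ _ (by positivity), ← ENNReal.rpow_mul]
      congr 2
      field_simp

end QShearlet

end

open QShearlet in
theorem mainTheorem4 (n : ℕ) [NeZero n] (φ ψ : Rn (2 * n) → ℍ[ℝ])
    (hφ : IsAdmissible φ) (hψ : IsAdmissible ψ)
    (hφc : ConvCondition φ) (hψc : ConvCondition ψ)
    (p : ℝ) (hp : 1 ≤ p) (f g : Rn (2 * n) → ℍ[ℝ])
    (hf : MemLp f 2 volume) (hg : MemLp g 2 volume) :
    MemLp (fun z => shearletTransform φ f z * shearletTransform ψ g z)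
        (ENNReal.ofReal p) (haarMeasure n) ∧
      (eLpNorm (fun z => shearletTransform φ f z * shearletTransform ψ g z)
          (ENNReal.ofReal p) (haarMeasure n)).toReal ≤
        (Real.sqrt ((admConst φ).toReal * (admConst ψ).toReal)) ^ (1 / p) *
          (eLpNorm f 2 volume).toReal * (eLpNorm g 2 volume).toReal *
          ((eLpNorm φ 2 volume).toReal * (eLpNorm ψ 2 volume).toReal) ^ (1 - 1 / p) := by
  obtain ⟨hφ2, hφC⟩ := hφ
  obtain ⟨hψ2, hψC⟩ := hψ
  obtain ⟨hm1, hb1⟩ := eLpNorm_shearletTransform_le hφ2 hφc hf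
  obtain ⟨hm2, hb2⟩ := eLpNorm_shearletTransform_le hψ2 hψc hg
  set F := fun z => shearletTransform φ f z * shearletTransform ψ g z with hF
  have hp0 : 0 < p := by linarith
  set Nf := eLpNorm f 2 volume with hNf
  set Ng := eLpNorm g 2 volume with hNg
  set Nφ := eLpNorm φ 2 volume with hNφ
  set Nψ := eLpNorm ψ 2 volume with hNψ
  have hNft : Nf ≠ ∞ := hf.2.ne
  have hNgt : Ng ≠ ∞ := hg.2.ne
  have hNφt : Nφ ≠ ∞ := hφ2.2.ne
  have hNψt : Nψ ≠ ∞ := hψ2.2.ne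
  have hFm : AEStronglyMeasurable F (haarMeasure n) := hm1.mul hm2
  have hsup : ∀ᵐ z ∂(haarMeasure n), ‖F z‖ₑ ≤ (Nf * Nφ) * (Ng * Nψ) := by
    filter_upwards [ae_haarMeasure_ne_zero] with z hz
    rw [hF, enorm_mul]
    exact mul_le_mul' (enorm_shearletTransform_le hφ2.1 hf.1 hz)
      (enorm_shearletTransform_le hψ2.1 hg.1 hz)
  have hroot : ∀ {x c N : ℝ≥0∞}, x ^ 2 ≤ c * N ^ 2 → x ≤ c ^ (1 / 2 : ℝ) * N := by
    intro x c N h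
    rw [← ENNReal.rpow_natCast, ← ENNReal.rpow_natCast] at h
    have h' := ENNReal.rpow_le_rpow h (z := 1 / 2) (by norm_num)
    rw [ENNReal.mul_rpow_of_nonneg _ _ (by norm_num), ← ENNReal.rpow_mul, ← ENNReal.rpow_mul] at h'
    norm_num at h' ⊢
    exact h'
  have hL1 : ∫⁻ z, ‖F z‖ₑ ∂(haarMeasure n) ≤
      ((admConst φ) ^ (1 / 2 : ℝ) * Nf) * ((admConst ψ) ^ (1 / 2 : ℝ) * Ng) := by
    simp only [hF, enorm_mul]
    exact (lintegral_enorm_mul_le hm1 hm2).trans (mul_le_mul' (hroot hb1) (hroot hb2))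
  have hmain := eLpNorm_le_of_ae_le_of_lintegral_le hp hsup (by finiteness) hL1
  have h1p : 0 ≤ 1 - 1 / p := by
    rw [sub_nonneg, div_le_one hp0]; exact hp
  have hfin : (((admConst φ) ^ (1 / 2 : ℝ) * Nf) * ((admConst ψ) ^ (1 / 2 : ℝ) * Ng)) ^ (1 / p) *
      ((Nf * Nφ) * (Ng * Nψ)) ^ (1 - 1 / p) ≠ ∞ := by
    have := hφC.ne
    have := hψC.ne
    refine ENNReal.mul_ne_top (ENNReal.rpow_ne_top_of_nonneg (by positivity) ?_)
      (ENNReal.rpow_ne_top_of_nonneg h1p (by finiteness))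
    finiteness
  refine ⟨⟨hFm, hmain.trans_lt (lt_top_iff_ne_top.2 hfin)⟩, ?_⟩
  refine (ENNReal.toReal_mono hfin hmain).trans_eq ?_
  simp only [ENNReal.toReal_mul, ← ENNReal.toReal_rpow]
  have hsplit : ∀ x : ℝ, 0 ≤ x → x ^ (1 / p) * x ^ (1 - 1 / p) = x := fun x hx => by
    rw [← Real.rpow_add_of_nonneg hx (by positivity) h1p, add_sub_cancel, Real.rpow_one]
  rw [Real.sqrt_mul ENNReal.toReal_nonneg, Real.sqrt_eq_rpow, Real.sqrt_eq_rpow]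
  set x := Nf.toReal
  set y := Ng.toReal
  have hx : 0 ≤ x := ENNReal.toReal_nonneg
  have hy : 0 ≤ y := ENNReal.toReal_nonneg
  have hc : ∀ c : ℝ≥0∞, 0 ≤ c.toReal := fun c => ENNReal.toReal_nonneg
  have hc' : ∀ c : ℝ≥0∞, 0 ≤ c.toReal ^ (1 / 2 : ℝ) := fun c => Real.rpow_nonneg (hc c) _
  rw [show (admConst φ).toReal ^ (1 / 2 : ℝ) * x * ((admConst ψ).toReal ^ (1 / 2 : ℝ) * y) =
      (admConst φ).toReal ^ (1 / 2 : ℝ) * (admConst ψ).toReal ^ (1 / 2 : ℝ) * (x * y) by ring,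
    show x * Nφ.toReal * (y * Nψ.toReal) = (x * y) * (Nφ.toReal * Nψ.toReal) by ring,
    Real.mul_rpow (mul_nonneg (hc' _) (hc' _)) (mul_nonneg hx hy),
    Real.mul_rpow (mul_nonneg hx hy) (mul_nonneg (hc _) (hc _))]
  have e := hsplit (x * y) (mul_nonneg hx hy)
  linear_combination
    ((admConst φ).toReal ^ (1 / 2 : ℝ) * (admConst ψ).toReal ^ (1 / 2 : ℝ)) ^ (1 / p) *
    (Nφ.toReal * Nψ.toReal) ^ (1 - 1 / p) * e
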